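/- Let $q$ be a prime power and let $n,k,t$ be integers with $t>0$, $k>t+1$, and either $q\ge 4$ and $n>2k+t+2$, or $q=3$ and $n>2k+t+3$. A $d$-space of $\mathrm{PG}(n,q)$ is a subspace of projective dimension $d$. For integers $0\le b\le a$ write $$\genfrac{[}{]}{0pt}{}{a}{b}=\frac{(q^a-1)\cdots(q^{a-b+1}-1)}{(q^b-1)\cdots(q-1)}$$ for the Gaussian coefficient (equal to $1$ if $b=0$), put $\theta_m=\genfrac{[}{]}{0pt}{}{m+1}{1}$, and let $$f_p(q,n,k,t)=\max\Big\{\theta_{k+1}-\theta_{k-t}+\genfrac{[}{]}{0pt}{}{n-t}{k-t}-q^{(k-t+1)(k-t)}\genfrac{[}{]}{0pt}{}{n-k-1}{k-t},\ \ \theta_{t+2}\Big(\genfrac{[}{]}{0pt}{}{n-t-1}{k-t-1}-\genfrac{[}{]}{0pt}{}{n-t-2}{k-t-2}\Big)+\genfrac{[}{]}{0pt}{}{n-t-2}{k-t-2}\Big\}.$$ Let $\mathcal S$ be a set of $k$-spaces of $\mathrm{PG}(n,q)$, pairwise intersecting in at least a $t$-space, that is maximal with respect to inclusion among such sets. Suppose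 that $\mathcal S$ is not a $t$-pencil, i.e. not the set of all $k$-spaces containing some fixed $t$-space. Then $$|\mathcal S|\le f_p(q,n,k,t).$$ Moreover, equality holds if and only if one of the following holds: (i) $k>2t+2$, and there are a $t$-space $\delta$ and a $k$-space $\pi$ with $\dim(\pi\cap\delta)=t-1$ such that $\mathcal S$ consists of all $k$-spaces contained in $\langle\pi,\delta\rangle$ together with all $k$-spaces that contain $\delta$ and meet $\langle\pi,\delta\rangle$ in at least a $(t+1)$-space; (ii) $k\le 2t+2$, and there is a $(t+2)$-space $\Gamma$ such that $\mathcal S$ is the set of all $k$-spaces meeting $\Gamma$ in at least a $(t+1)$-space. -/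

import Mathlib

/-!
The projective space `PG(n,q)` is the lattice of subspaces of an `(n+1)`-dimensional vector space
`V` over a field `F` with `q` elements. A `d`-space, i.e. a subspace of projective dimension `d`,
is a linear subspace of dimension `d + 1`.
-/

namespace ProjHM

section Counting

/-- The `q`-ary Gaussian coefficient
`((q^n - 1) ⋯ (q^(n-k+1) - 1)) / ((q^k - 1) ⋯ (q - 1))`, for `k ≤ n`. -/
def gaussBinom (q n k : ℕ) : ℚ :=
  (∏ i ∈ Finset.range k, ((q : ℚ) ^ (n - i) - 1)) /
    ∏ i ∈ Finset.range k, ((q : ℚ) ^ (i + 1) - 1)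

/-- The number `θ_m` of points of `PG(m,q)`. -/
def theta (q m : ℕ) : ℚ := gaussBinom q (m + 1) 1

/-- The function `f_p(q,n,k,t)`, used for `t + 1 < k` and `2 * k - t < n`, where no
subtraction of natural numbers below is truncated. -/
def fp (q n k t : ℕ) : ℚ :=
  max
    (theta q (k + 1) - theta q (k - t) + gaussBinom q (n - t) (k - t)
      - (q : ℚ) ^ ((k - t + 1) * (k - t)) * gaussBinom q (n - k - 1) (k - t))
    (theta q (t + 2) * (gaussBinom q (n - t - 1) (k - t - 1) - gaussBinom q (n - t - 2) (k - t - 2))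
      + gaussBinom q (n - t - 2) (k - t - 2))

end Counting

section Families

variable {F V : Type*} [Field F] [AddCommGroup V] [Module F V]

/-- `W` is a `d`-space: its projective dimension is `d`. -/
def IsSpace (d : ℕ) (W : Submodule F V) : Prop := Module.finrank F W = d + 1

/-- `A` and `B` meet in at least a `d`-space. -/
def MeetAtLeast (d : ℕ) (A B : Submodule F V) : Prop :=
  d + 1 ≤ Module.finrank F (A ⊓ B : Submodule F V)

/-- `S` is a set of `k`-spaces pairwise intersecting in at least a `t`-space. -/
def IsIntersectingFamily (k t : ℕ) (S : Set (Submodule F V)) : Prop :=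
  (∀ A ∈ S, IsSpace k A) ∧ ∀ A ∈ S, ∀ B ∈ S, A ≠ B → MeetAtLeast t A B

/-- `S` is a `t`-pencil: the set of all `k`-spaces through some fixed `t`-space. -/
def IsPencil (k t : ℕ) (S : Set (Submodule F V)) : Prop :=
  ∃ δ : Submodule F V, IsSpace t δ ∧ S = {A | IsSpace k A ∧ δ ≤ A}

/-- For some `t`-space `δ` and `k`-space `π` meeting in a `(t-1)`-space (a linear subspace of
dimension `t`), `S` consists of all `k`-spaces in `⟨π, δ⟩` together with all `k`-spaces through `δ`
meeting `⟨π, δ⟩` in at least a `(t+1)`-space. -/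
def IsSpanExample (k t : ℕ) (S : Set (Submodule F V)) : Prop :=
  ∃ δ π : Submodule F V, IsSpace t δ ∧ IsSpace k π ∧
    Module.finrank F (π ⊓ δ : Submodule F V) = t ∧
    S = {A | IsSpace k A ∧ A ≤ π ⊔ δ} ∪
      {A | IsSpace k A ∧ δ ≤ A ∧ MeetAtLeast (t + 1) A (π ⊔ δ)}

/-- For some `(t+2)`-space `Γ`, `S` consists of all `k`-spaces meeting `Γ` in at least a
`(t+1)`-space. -/
def IsCoreExample (k t : ℕ) (S : Set (Submodule F V)) : Prop :=
  ∃ Γ : Submodule F V, IsSpace (t + 2) Γ ∧ S = {A | IsSpace k A ∧ MeetAtLeast (t + 1) A Γ}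

end Families

end ProjHM

namespace ProjHM

open Module

/-! ### Counting subspaces disjoint from a given one -/

section Subspaces

variable {F V : Type*} [Field F] [Finite F] [AddCommGroup V] [Module F V] [Module.Finite F V]

/-! Dimensions below are linear: members of `S` have dimension t+m, the ambient space t+m+c, and t
is one more than the projective t. Call X a cover if it meets every member in dimension at least t,
and let t+s be the least dimension of a cover; s ≥ 1 since `S` is not a pencil.

The counting device is a branching step. If X is not a cover, some member B meets it in dimension
less than t, so B contains an (m+1)-space E disjoint from X. By dimension every member meets E, so
each member through X contains X + P for one of the [m+1,1] points P of E (`exists_transversal`,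
`ncard_le_mul_of_not_cover`). Each non-cover thus costs a factor [m+1,1] and raises the dimension by
one, which gains about q^c because c is large.

If s ≥ 2, s branchings from the t-subspaces of a minimal cover show that `S` is smaller than the
span example. If s = 1, maximality makes the (t+1)-dimensional covers meet pairwise in dimension at
least t, so either three of them span a (t+2)-space that every member meets in dimension at least
t+1, which is the core example, or all pass through one t-space δ. In the latter case let U be the
sum of these covers. A member A not through δ satisfies U ≤ A + δ, of dimension t+m+1. If U has that
dimension, all such A lie in U and `S` is the span example; otherwise too few points of a
transversal lie in U, and branching makes `S` too small (`center_estimate`).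

It remains to compute the two examples (`ncard_core`, `ncard_span`) and compare them
(`span_bounds`). The leading terms are [t+2,1] and [m+1,1] times the same coefficient, so m = t+1 is
the delicate case and needs the second-order terms. -/

theorem card_linearIndependent_mkQ (W : Submodule F V) {m d : ℕ}
    (hd : finrank F V = finrank F W + d) (hm : m ≤ d) :
    Nat.card {s : Fin m → V // LinearIndependent F (W.mkQ ∘ s)} =
      Nat.card F ^ (finrank F W * m) * ∏ i : Fin m, (Nat.card F ^ d - Nat.card F ^ i.val) := by
  have : Fintype F := Fintype.ofFinite F
  have : Finite V := Module.finite_of_finite F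
  obtain ⟨W', hW'⟩ := W.exists_isCompl
  have hd' : finrank F W' = d := by
    have := Submodule.finrank_add_eq_of_isCompl hW'
    omega
  let e := Submodule.prodEquivOfIsCompl W W' hW'
  have key : ∀ s : Fin m → V, LinearIndependent F (W.mkQ ∘ s) ↔
      LinearIndependent F (fun i => (e.symm (s i)).2) := by
    intro s
    have h1 : W.mkQ ∘ s = (W.mkQ ∘ₗ W'.subtype) ∘ (fun i => (e.symm (s i)).2) := by
      funext i
      have : s i = (e.symm (s i)).1 + (e.symm (s i)).2 := by
        have := e.apply_symm_apply (s i)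
        rw [← Submodule.coe_prodEquivOfIsCompl' W W' hW']
        exact this.symm
      simp only [Function.comp_apply, LinearMap.comp_apply, Submodule.subtype_apply]
      conv_lhs => rw [this]
      simp
    rw [h1]
    apply LinearMap.linearIndependent_iff
    rw [LinearMap.ker_eq_bot, ← LinearMap.ker_eq_bot, LinearMap.ker_comp, Submodule.ker_mkQ,
      ← Submodule.disjoint_iff_comap_eq_bot]
    exact hW'.symm.disjoint
  -- Only the components along a complement W' matter for independence modulo W; the components in W
  -- are arbitrary and give the power of q.
  have e1 : {s : Fin m → V // LinearIndependent F (W.mkQ ∘ s)} ≃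
      (Fin m → W) × {s : Fin m → W' // LinearIndependent F s} :=
    { toFun := fun s => (fun i => (e.symm (s.1 i)).1, ⟨fun i => (e.symm (s.1 i)).2, (key _).1 s.2⟩)
      invFun := fun p => ⟨fun i => e (p.1 i, p.2.1 i), (key _).2 (by simpa using p.2.2)⟩
      left_inv := fun s => by ext i; simp
      right_inv := fun p => by ext <;> simp }
  rw [Nat.card_congr e1, Nat.card_prod, card_linearIndependent (by omega), hd', Nat.card_fun,
    Module.natCard_eq_pow_finrank (K := F)]
  simp [pow_mul]

/-- A family independent modulo W is the same thing as an ordered basis of its span C, and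
independence modulo W says exactly that C is disjoint from W. -/
theorem card_disjoint_mul (W : Submodule F V) {m d : ℕ}
    (hd : finrank F V = finrank F W + d) (hm : m ≤ d) :
    Nat.card {C : Submodule F V // finrank F C = m ∧ Disjoint C W} *
        ∏ i : Fin m, (Nat.card F ^ m - Nat.card F ^ i.val) =
      Nat.card F ^ (finrank F W * m) * ∏ i : Fin m, (Nat.card F ^ d - Nat.card F ^ i.val) := by
  have : Fintype F := Fintype.ofFinite F
  have : Finite V := Module.finite_of_finite F
  rw [← card_linearIndependent_mkQ W hd hm]
  have ext : ∀ a b : (Σ C : {C : Submodule F V // finrank F C = m ∧ Disjoint C W},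
      {s : Fin m → C.1 // LinearIndependent F s}),
      a.1.1 = b.1.1 → (∀ i, (a.2.1 i : V) = b.2.1 i) → a = b := by
    rintro ⟨⟨C, hC⟩, s, hs⟩ ⟨⟨D, hD⟩, s', hs'⟩ h h'
    obtain rfl : C = D := h
    obtain rfl : s = s' := funext fun i => Subtype.ext (h' i)
    rfl
  have e : {s : Fin m → V // LinearIndependent F (W.mkQ ∘ s)} ≃
      Σ C : {C : Submodule F V // finrank F C = m ∧ Disjoint C W},
        {s : Fin m → C.1 // LinearIndependent F s} :=
    { toFun := fun s => ⟨⟨Submodule.span F (Set.range s.1),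
          by rw [finrank_span_eq_card s.2.of_comp, Fintype.card_fin],
          by simpa using Submodule.range_ker_disjoint s.2⟩,
          ⟨fun i => ⟨s.1 i, Submodule.subset_span ⟨i, rfl⟩⟩,
            LinearIndependent.of_comp (Submodule.subtype _) s.2.of_comp⟩⟩
      invFun := fun p => ⟨fun i => p.2.1 i, by
        have h : LinearIndependent F (fun i => (p.2.1 i : V)) :=
          p.2.2.map' (Submodule.subtype _) (Submodule.ker_subtype _)
        refine (LinearMap.linearIndependent_iff_of_disjoint _ ?_).2 h
        rw [Submodule.ker_mkQ]
        refine p.1.2.2.mono_left ?_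
        rw [Submodule.span_le]
        rintro _ ⟨i, rfl⟩
        exact (p.2.1 i).2⟩
      left_inv := fun s => rfl
      right_inv := fun p => by
        refine ext _ _ ?_ fun i => rfl
        apply Submodule.eq_of_le_of_finrank_le
        · rw [Submodule.span_le]
          rintro _ ⟨i, rfl⟩
          exact (p.2.1 i).2
        · have h : LinearIndependent F (fun i => (p.2.1 i : V)) :=
            p.2.2.map' (Submodule.subtype _) (Submodule.ker_subtype _)
          exact (p.1.2.1.trans ((finrank_span_eq_card h).trans (Fintype.card_fin m)).symm).le }
  have : Fintype {C : Submodule F V // finrank F C = m ∧ Disjoint C W} := Fintype.ofFinite _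
  rw [Nat.card_congr e, Nat.card_sigma]
  have : ∀ C : {C : Submodule F V // finrank F C = m ∧ Disjoint C W},
      Nat.card {s : Fin m → C.1 // LinearIndependent F s} =
        ∏ i : Fin m, (Nat.card F ^ m - Nat.card F ^ i.val) := by
    intro C
    rw [card_linearIndependent C.2.1.ge, C.2.1, Nat.card_eq_fintype_card]
  simp [this]

theorem gaussBinom_mul_prod {q : ℕ} (hq : 2 ≤ q) {m d : ℕ} (hm : m ≤ d) :
    gaussBinom q d m * ∏ i : Fin m, ((q : ℚ) ^ m - (q : ℚ) ^ i.val) =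
      ∏ i : Fin m, ((q : ℚ) ^ d - (q : ℚ) ^ i.val) := by
  have hq1 : (1 : ℚ) < q := by exact_mod_cast hq
  have h : ∀ e, m ≤ e → ∏ i : Fin m, ((q : ℚ) ^ e - (q : ℚ) ^ i.val) =
      (∏ i ∈ Finset.range m, (q : ℚ) ^ i) * ∏ i ∈ Finset.range m, ((q : ℚ) ^ (e - i) - 1) := by
    intro e he
    rw [Fin.prod_univ_eq_prod_range (fun i => (q : ℚ) ^ e - (q : ℚ) ^ i), ← Finset.prod_mul_distrib]
    refine Finset.prod_congr rfl fun i hi => ?_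
    rw [Finset.mem_range] at hi
    rw [mul_sub, ← pow_add, mul_one]
    congr 2
    omega
  have h2 : ∏ i ∈ Finset.range m, ((q : ℚ) ^ (m - i) - 1) =
      ∏ i ∈ Finset.range m, ((q : ℚ) ^ (i + 1) - 1) := by
    rw [← Finset.prod_range_reflect]
    refine Finset.prod_congr rfl fun i hi => ?_
    rw [Finset.mem_range] at hi
    congr 2
    omega
  have h3 : ∏ i ∈ Finset.range m, ((q : ℚ) ^ (i + 1) - 1) ≠ 0 := by
    refine Finset.prod_ne_zero_iff.2 fun i _ => ?_
    have := one_lt_pow₀ hq1 (Nat.succ_ne_zero i)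
    exact (sub_pos.2 this).ne'
  rw [h m le_rfl, h d hm, h2, gaussBinom]
  field_simp

theorem card_disjoint (W : Submodule F V) {m d : ℕ}
    (hd : finrank F V = finrank F W + d) (hm : m ≤ d) :
    (Nat.card {C : Submodule F V // finrank F C = m ∧ Disjoint C W} : ℚ) =
      (Nat.card F : ℚ) ^ (finrank F W * m) * gaussBinom (Nat.card F) d m := by
  have hq : 2 ≤ Nat.card F := Finite.one_lt_card
  have hq1 : (1 : ℚ) < Nat.card F := by exact_mod_cast hq
  have h := congrArg (Nat.cast : ℕ → ℚ) (card_disjoint_mul W hd hm)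
  have hc : ∀ e, m ≤ e → ((∏ i : Fin m, (Nat.card F ^ e - Nat.card F ^ i.val) : ℕ) : ℚ) =
      ∏ i : Fin m, ((Nat.card F : ℚ) ^ e - (Nat.card F : ℚ) ^ i.val) := by
    intro e he
    rw [Nat.cast_prod]
    refine Finset.prod_congr rfl fun i _ => ?_
    rw [Nat.cast_sub (Nat.pow_le_pow_right (by omega) (by omega))]
    push_cast
    rfl
  rw [Nat.cast_mul, Nat.cast_mul, hc m le_rfl, hc d hm, ← gaussBinom_mul_prod hq hm,
    ← mul_assoc, Nat.cast_pow] at h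
  refine mul_right_cancel₀ ?_ h
  refine Finset.prod_ne_zero_iff.2 fun i _ => ?_
  exact (sub_pos.2 (pow_lt_pow_right₀ hq1 i.2)).ne'

end Subspaces

theorem gaussBinom_pos {q n k : ℕ} (hq : 2 ≤ q) (hk : k ≤ n) : 0 < gaussBinom q n k := by
  have hq1 : (1 : ℚ) < q := by exact_mod_cast hq
  refine div_pos (Finset.prod_pos fun i hi => ?_) (Finset.prod_pos fun i _ => ?_)
  · rw [Finset.mem_range] at hi
    exact sub_pos.2 (one_lt_pow₀ hq1 (by omega))
  · exact sub_pos.2 (one_lt_pow₀ hq1 (by omega))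

/-! ### Counting subspaces between, above and below given ones -/

section Subspaces

variable {F V : Type*} [Field F] [AddCommGroup V] [Module F V] [Module.Finite F V]

theorem finrank_comap_mkQ (X : Submodule F V) (C : Submodule F (V ⧸ X)) :
    finrank F (C.comap X.mkQ) = finrank F X + finrank F C := by
  have h := LinearMap.finrank_range_add_finrank_ker (X.mkQ.domRestrict (C.comap X.mkQ))
  have h1 : LinearMap.range (X.mkQ.domRestrict (C.comap X.mkQ)) = C := by
    rw [LinearMap.range_domRestrict, Submodule.map_comap_eq_of_surjective X.mkQ_surjective]
  have h2 : finrank F (LinearMap.ker (X.mkQ.domRestrict (C.comap X.mkQ))) = finrank F X := by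
    rw [LinearMap.ker_domRestrict, Submodule.ker_mkQ]
    apply (Submodule.comapSubtypeEquivOfLe _).finrank_eq
    exact Submodule.le_comap_mkQ X C
  rw [h1, h2] at h
  omega

theorem finrank_map_mkQ {X U : Submodule F V} (h : X ≤ U) :
    finrank F U = finrank F X + finrank F (U.map X.mkQ) := by
  rw [← finrank_comap_mkQ, Submodule.comap_map_mkQ, sup_eq_right.2 h]

variable [Finite F]

/-- Passing to V/X turns the condition A ⊓ U = X into disjointness from U/X. Here s, w and d are the
dimensions of X, U/X and V/U. -/
theorem ncard_inf_eq {X U : Submodule F V} (hXU : X ≤ U) {s w d j : ℕ}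
    (hX : finrank F X = s) (hU : finrank F U = s + w) (hV : finrank F V = s + w + d)
    (hj : j ≤ d) :
    ({A : Submodule F V | finrank F A = s + j ∧ X ≤ A ∧ A ⊓ U = X}.ncard : ℚ) =
      (Nat.card F : ℚ) ^ (w * j) * gaussBinom (Nat.card F) d j := by
  have hw : finrank F (U.map X.mkQ) = w := by
    have := finrank_map_mkQ hXU
    omega
  have hQ := Submodule.finrank_quotient_add_finrank X
  rw [← hw, ← card_disjoint (U.map X.mkQ) (m := j) (d := d) (by omega) hj]
  congr 1
  have hiff : ∀ C : Submodule F (V ⧸ X),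
      C.comap X.mkQ ⊓ U = X ↔ Disjoint C (U.map X.mkQ) := by
    intro C
    have h1 : C.comap X.mkQ ⊓ U = (C ⊓ U.map X.mkQ).comap X.mkQ := by
      rw [Submodule.comap_inf, Submodule.comap_map_mkQ, sup_eq_right.2 hXU]
    have h2 : X = (⊥ : Submodule F (V ⧸ X)).comap X.mkQ := by
      rw [← LinearMap.ker, Submodule.ker_mkQ]
    rw [disjoint_iff, h1]
    conv_lhs => rhs; rw [h2]
    exact (Submodule.comap_injective_of_surjective X.mkQ_surjective).eq_iff
  symm
  refine Set.ncard_congr (s := {C : Submodule F (V ⧸ X) |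
    finrank F C = j ∧ Disjoint C (U.map X.mkQ)}) (fun C _ => C.comap X.mkQ) ?_ ?_ ?_
  · rintro C ⟨h1, h2⟩
    exact ⟨by rw [finrank_comap_mkQ, hX, h1], Submodule.le_comap_mkQ X C, (hiff C).2 h2⟩
  · intro C D _ _ h
    exact Submodule.comap_injective_of_surjective X.mkQ_surjective h
  · rintro A ⟨h1, h2, h3⟩
    have h4 : (A.map X.mkQ).comap X.mkQ = A := by
      rw [Submodule.comap_map_mkQ, sup_eq_right.2 h2]
    refine ⟨A.map X.mkQ, ⟨?_, (hiff _).1 (by rw [h4, h3])⟩, h4⟩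
    have := finrank_map_mkQ h2
    omega

theorem ncard_le {X : Submodule F V} {s d j : ℕ}
    (hX : finrank F X = s) (hV : finrank F V = s + d) (hj : j ≤ d) :
    ({A : Submodule F V | finrank F A = s + j ∧ X ≤ A}.ncard : ℚ) =
      gaussBinom (Nat.card F) d j := by
  have h := ncard_inf_eq (le_refl X) (w := 0) hX (by omega) (by omega) hj
  rw [zero_mul, pow_zero, one_mul] at h
  rw [← h]
  congr 3
  ext A
  simp only [inf_eq_right]
  tauto

theorem ncard_interval {X Y : Submodule F V} (hXY : X ≤ Y) {s d j : ℕ}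
    (hX : finrank F X = s) (hY : finrank F Y = s + d) (hj : j ≤ d) :
    ({A : Submodule F V | finrank F A = s + j ∧ X ≤ A ∧ A ≤ Y}.ncard : ℚ) =
      gaussBinom (Nat.card F) d j := by
  have hX' : finrank F (X.comap Y.subtype) = s := by
    rw [← hX]
    exact (Submodule.comapSubtypeEquivOfLe hXY).finrank_eq
  rw [← ncard_le hX' hY hj]
  congr 1
  symm
  refine Set.ncard_congr (fun C _ => C.map Y.subtype) ?_ ?_ ?_
  · rintro C ⟨h1, h2⟩
    refine ⟨by rw [Submodule.finrank_map_subtype_eq, h1], ?_, Submodule.map_subtype_le Y C⟩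
    have := Submodule.map_mono (f := Y.subtype) h2
    rwa [Submodule.map_comap_subtype, inf_eq_right.2 hXY] at this
  · intro C D _ _ h
    exact Submodule.map_injective_of_injective Y.injective_subtype h
  · rintro A ⟨h1, h2, h3⟩
    refine ⟨A.comap Y.subtype, ⟨?_, Submodule.comap_mono h2⟩, ?_⟩
    · rw [← h1]
      exact (Submodule.comapSubtypeEquivOfLe h3).finrank_eq
    · rw [Submodule.map_comap_subtype, inf_eq_right.2 h3]

theorem ncard_ge {Y : Submodule F V} {d j : ℕ} (hY : finrank F Y = d) (hj : j ≤ d) :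
    ({A : Submodule F V | finrank F A = j ∧ A ≤ Y}.ncard : ℚ) = gaussBinom (Nat.card F) d j := by
  have h := ncard_interval (bot_le : ⊥ ≤ Y) (s := 0) (d := d) (by simp) (by omega) hj
  simpa using h

/-- Existence is read off from the count, which is positive. -/
theorem exists_inf_eq {X U : Submodule F V} (hXU : X ≤ U) {s w d j : ℕ}
    (hX : finrank F X = s) (hU : finrank F U = s + w) (hV : finrank F V = s + w + d)
    (hj : j ≤ d) : ∃ A : Submodule F V, finrank F A = s + j ∧ X ≤ A ∧ A ⊓ U = X := by
  have hq : 2 ≤ Nat.card F := Finite.one_lt_card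
  have h := ncard_inf_eq hXU hX hU hV hj
  by_contra hne
  have : {A : Submodule F V | finrank F A = s + j ∧ X ≤ A ∧ A ⊓ U = X} = ∅ :=
    Set.eq_empty_iff_forall_notMem.2 fun A hA => hne ⟨A, hA⟩
  rw [this, Set.ncard_empty] at h
  have h1 : 0 < (Nat.card F : ℚ) ^ (w * j) * gaussBinom (Nat.card F) d j :=
    mul_pos (pow_pos (by exact_mod_cast (by omega : 0 < Nat.card F)) _) (gaussBinom_pos hq hj)
  exact h1.ne (by exact_mod_cast h)

theorem exists_le_disjoint (Y X : Submodule F V) {j : ℕ}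
    (hj : finrank F (Y ⊓ X : Submodule F V) + j ≤ finrank F Y) :
    ∃ E : Submodule F V, E ≤ Y ∧ finrank F E = j ∧ Disjoint E X := by
  have hX' : finrank F (X.comap Y.subtype) = finrank F (Y ⊓ X : Submodule F V) := by
    rw [← Submodule.map_comap_subtype, Submodule.finrank_map_subtype_eq]
  obtain ⟨A, h1, -, h3⟩ := exists_inf_eq (bot_le : ⊥ ≤ X.comap Y.subtype) (s := 0) (j := j)
    (w := finrank F (Y ⊓ X : Submodule F V))
    (d := finrank F Y - finrank F (Y ⊓ X : Submodule F V)) (by simp) (by omega) (by omega) (by omega)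
  refine ⟨A.map Y.subtype, Submodule.map_subtype_le Y A, ?_, ?_⟩
  · rw [Submodule.finrank_map_subtype_eq]
    omega
  · rw [Submodule.disjoint_def]
    rintro _ ⟨a, ha, rfl⟩ hX
    have : a ∈ A ⊓ X.comap Y.subtype := ⟨ha, hX⟩
    rw [h3, Submodule.mem_bot] at this
    rw [this, map_zero]

end Subspaces

/-! ### Gaussian coefficients and counting by fibres -/

theorem gaussBinom_one_right (q a : ℕ) : gaussBinom q a 1 = ((q : ℚ) ^ a - 1) / (q - 1) := by
  simp [gaussBinom]

theorem gaussBinom_zero_right (q a : ℕ) : gaussBinom q a 0 = 1 := by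
  simp [gaussBinom]

theorem gaussBinom_succ_succ {q : ℕ} (hq : 2 ≤ q) (n k : ℕ) :
    gaussBinom q (n + 1) (k + 1) * ((q : ℚ) ^ (k + 1) - 1) =
      ((q : ℚ) ^ (n + 1) - 1) * gaussBinom q n k := by
  have hq1 : (1 : ℚ) < q := by exact_mod_cast hq
  have h : ∀ i : ℕ, (q : ℚ) ^ (i + 1) - 1 ≠ 0 := fun i =>
    (sub_pos.2 (one_lt_pow₀ hq1 (Nat.succ_ne_zero i))).ne'
  rw [gaussBinom, gaussBinom, Finset.prod_range_succ', Finset.prod_range_succ _ k]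
  simp only [Nat.add_sub_add_right, Nat.sub_zero]
  have h3 : ∏ i ∈ Finset.range k, ((q : ℚ) ^ (i + 1) - 1) ≠ 0 :=
    Finset.prod_ne_zero_iff.2 fun i _ => h i
  have := h k
  field_simp

theorem gaussBinom_succ_self {q : ℕ} (hq : 2 ≤ q) (a : ℕ) :
    gaussBinom q (a + 1) a = gaussBinom q (a + 1) 1 := by
  have hq1 : (1 : ℚ) < q := by exact_mod_cast hq
  have hne : (q : ℚ) - 1 ≠ 0 := (sub_pos.2 hq1).ne'
  induction a with
  | zero => rw [gaussBinom_zero_right, gaussBinom_one_right, zero_add, pow_one, div_self hne]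
  | succ a ih =>
    have h := gaussBinom_succ_succ hq (a + 1) a
    have h1 : (q : ℚ) ^ (a + 1) - 1 ≠ 0 := (sub_pos.2 (one_lt_pow₀ hq1 (Nat.succ_ne_zero a))).ne'
    rw [ih, gaussBinom_one_right] at h
    rw [gaussBinom_one_right]
    field_simp at h ⊢
    linarith

/-- The ratio of the two coefficients is (q^(k+1+c) - 1)/(q^(k+1) - 1), which is at least q^c. This
is the gain per dimension in every estimate. -/
theorem pow_mul_gaussBinom_le {q : ℕ} (hq : 2 ≤ q) (c k : ℕ) :
    (q : ℚ) ^ c * gaussBinom q (k + c) k ≤ gaussBinom q (k + 1 + c) (k + 1) := by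
  have hq1 : (1 : ℚ) < q := by exact_mod_cast hq
  have h := gaussBinom_succ_succ hq (k + c) k
  have h1 : 0 < (q : ℚ) ^ (k + 1) - 1 := sub_pos.2 (one_lt_pow₀ hq1 (Nat.succ_ne_zero k))
  have h2 : (1 : ℚ) ≤ (q : ℚ) ^ c := one_le_pow₀ hq1.le
  have h3 := gaussBinom_pos hq (Nat.le_add_right k c)
  rw [show k + 1 + c = k + c + 1 by ring]
  refine le_of_mul_le_mul_right ?_ h1
  rw [h, show k + c + 1 = c + (k + 1) by ring, pow_add _ c (k + 1)]
  nlinarith [mul_nonneg (sub_nonneg.2 h2) h3.le]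

theorem pow_le_gaussBinom {q : ℕ} (hq : 2 ≤ q) (c k : ℕ) :
    (q : ℚ) ^ (c * k) ≤ gaussBinom q (k + c) k := by
  induction k with
  | zero => simp [gaussBinom_zero_right]
  | succ k ih =>
    refine le_trans ?_ (pow_mul_gaussBinom_le hq c k)
    rw [Nat.mul_succ, pow_add, mul_comm]
    gcongr

theorem ncard_le_mul {α ι : Type*} [Finite α] [Finite ι] {I : Set ι} {f : ι → Set α} {s : Set α}
    (h : ∀ a ∈ s, ∃ i ∈ I, a ∈ f i) {M : ℚ} (hM : ∀ i ∈ I, ((f i).ncard : ℚ) ≤ M) :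
    (s.ncard : ℚ) ≤ I.ncard * M := by
  have h1 : s ⊆ ⋃ i ∈ (Set.toFinite I).toFinset, f i := by
    intro a ha
    obtain ⟨i, hi, hai⟩ := h a ha
    simp only [Set.mem_iUnion]
    exact ⟨i, by simpa using hi, hai⟩
  have h2 := (Set.ncard_le_ncard h1 (Set.toFinite _)).trans (Finset.set_ncard_biUnion_le _ _)
  calc (s.ncard : ℚ) ≤ ∑ i ∈ (Set.toFinite I).toFinset, ((f i).ncard : ℚ) := by exact_mod_cast h2
    _ ≤ ∑ i ∈ (Set.toFinite I).toFinset, M :=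
      Finset.sum_le_sum fun i hi => hM i (by simpa using hi)
    _ = I.ncard * M := by
      rw [Finset.sum_const, nsmul_eq_mul, Set.ncard_eq_toFinset_card I (Set.toFinite I)]

theorem ncard_eq_mul {α ι : Type*} [Finite α] [Finite ι] {I : Set ι} {s : Set α} (g : α → ι)
    (h : ∀ a ∈ s, g a ∈ I) {M : ℚ} (hM : ∀ i ∈ I, (({a | a ∈ s ∧ g a = i} : Set α).ncard : ℚ) = M) :
    (s.ncard : ℚ) = I.ncard * M := by
  classical
  have h1 := Finset.card_eq_sum_card_fiberwise (f := g) (s := (Set.toFinite s).toFinset)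
    (t := (Set.toFinite I).toFinset) (fun a ha => by simpa using h a (by simpa using ha))
  rw [Set.ncard_eq_toFinset_card s (Set.toFinite s), h1,
    Set.ncard_eq_toFinset_card I (Set.toFinite I), Nat.cast_sum, ← nsmul_eq_mul, ← Finset.sum_const]
  refine Finset.sum_congr rfl fun i hi => ?_
  rw [← hM i (by simpa using hi), ← Set.ncard_coe_finset]
  congr 2
  ext a
  simp

/-! ### Transversals and the branching step -/

section Subspaces

variable {F V : Type*} [Field F] [AddCommGroup V] [Module F V]

theorem exists_point_le (W : Submodule F V) (h : 0 < finrank F W) :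
    ∃ P ≤ W, finrank F P = 1 := by
  have : W ≠ ⊥ := by
    rintro rfl
    simp at h
  obtain ⟨x, hx, hx0⟩ := W.exists_mem_ne_zero_of_ne_bot this
  exact ⟨Submodule.span F {x}, by simpa using hx, finrank_span_singleton hx0⟩

variable [Module.Finite F V]

theorem finrank_sup_of_disjoint {X P : Submodule F V} (h : Disjoint X P) :
    finrank F (X ⊔ P : Submodule F V) = finrank F X + finrank F P := by
  have := Submodule.finrank_sup_add_finrank_inf_eq X P
  rw [h.eq_bot, finrank_bot] at this
  omega

variable [Finite F]

/-- Inside B, of dimension t+m, an (m+1)-space and a space of dimension at least t must share a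
point. The bound on B ⊓ X leaves room to choose the (m+1)-space off X, so that its points properly
extend X. -/
theorem exists_transversal {B X : Submodule F V} {t m : ℕ} (hB : finrank F B = t + m)
    (hBX : finrank F (B ⊓ X : Submodule F V) < t) :
    ∃ E ≤ B, finrank F E = m + 1 ∧ Disjoint E X ∧ ∀ A : Submodule F V,
      t ≤ finrank F (A ⊓ B : Submodule F V) → ∃ P : Submodule F V, (finrank F P = 1 ∧ P ≤ E) ∧ P ≤ A := by
  obtain ⟨E, h1, h2, h3⟩ := exists_le_disjoint B X (j := m + 1) (by omega)
  refine ⟨E, h1, h2, h3, fun A hA => ?_⟩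
  have h4 := Submodule.finrank_sup_add_finrank_inf_eq (A ⊓ B) E
  have h5 : finrank F (A ⊓ B ⊔ E : Submodule F V) ≤ finrank F B :=
    Submodule.finrank_mono (sup_le inf_le_right h1)
  obtain ⟨P, h6, h7⟩ := exists_point_le (A ⊓ B ⊓ E) (by omega)
  exact ⟨P, ⟨h7, h6.trans inf_le_right⟩, h6.trans (inf_le_left.trans inf_le_left)⟩

theorem ncard_le_mul_of_not_cover (𝒜 : Set (Submodule F V)) {B X : Submodule F V} {t m : ℕ}
    (hB : finrank F B = t + m) (hBX : finrank F (B ⊓ X : Submodule F V) < t)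
    (h𝒜 : ∀ A ∈ 𝒜, t ≤ finrank F (A ⊓ B : Submodule F V)) {M : ℚ}
    (hM : ∀ Y, X ≤ Y → finrank F Y = finrank F X + 1 → (({A | A ∈ 𝒜 ∧ Y ≤ A} : Set _).ncard : ℚ) ≤ M) :
    (({A | A ∈ 𝒜 ∧ X ≤ A} : Set _).ncard : ℚ) ≤ gaussBinom (Nat.card F) (m + 1) 1 * M := by
  have : Finite V := Module.finite_of_finite F
  obtain ⟨E, -, h2, h3, h4⟩ := exists_transversal hB hBX
  rw [← ncard_ge h2 (by omega : 1 ≤ m + 1)]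
  refine ncard_le_mul (f := fun P => {A | A ∈ 𝒜 ∧ X ⊔ P ≤ A}) ?_ ?_
  · rintro A ⟨hA, hXA⟩
    obtain ⟨P, hP, hPA⟩ := h4 A (h𝒜 A hA)
    exact ⟨P, hP, hA, sup_le hXA hPA⟩
  · rintro P ⟨hP, hPE⟩
    refine hM _ le_sup_left ?_
    rw [finrank_sup_of_disjoint (h3.symm.mono_right hPE), hP]

end Subspaces

/-! ### Maximal families and their covers -/

section Subspaces

variable {F V : Type*} [Field F] [AddCommGroup V] [Module F V]

/-- `S` is a maximal family of subspaces of dimension `t + m` pairwise meeting in dimension at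
least `t`. -/
structure IsMaxFamily (t m : ℕ) (S : Set (Submodule F V)) : Prop where
  finrank_eq : ∀ A ∈ S, finrank F A = t + m
  le_finrank_inf : ∀ A ∈ S, ∀ B ∈ S, t ≤ finrank F (A ⊓ B : Submodule F V)
  mem : ∀ C : Submodule F V, finrank F C = t + m →
    (∀ A ∈ S, t ≤ finrank F (A ⊓ C : Submodule F V)) → C ∈ S

/-- `X` meets every member of `S` in dimension at least `t`. -/
def IsCover (t : ℕ) (S : Set (Submodule F V)) (X : Submodule F V) : Prop :=
  ∀ A ∈ S, t ≤ finrank F (A ⊓ X : Submodule F V)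

theorem IsMaxFamily.eq_of_subset {t m : ℕ} {S T : Set (Submodule F V)} (hS : IsMaxFamily t m S)
    (hST : S ⊆ T) (hT : ∀ A ∈ T, finrank F A = t + m)
    (hT' : ∀ A ∈ T, ∀ B ∈ T, t ≤ finrank F (A ⊓ B : Submodule F V)) : S = T :=
  hST.antisymm fun C hC => hS.mem C (hT C hC) fun A hA => hT' A (hST hA) C hC

variable [Module.Finite F V]

theorem finrank_add_le_of_le {X Y Z : Submodule F V} (hX : X ≤ Z) (hY : Y ≤ Z) :
    finrank F X + finrank F Y ≤ finrank F Z + finrank F (X ⊓ Y : Submodule F V) := by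
  have h1 := Submodule.finrank_sup_add_finrank_inf_eq X Y
  have h2 : finrank F (X ⊔ Y : Submodule F V) ≤ finrank F Z := Submodule.finrank_mono (sup_le hX hY)
  omega

theorem finrank_inf_lt_of_not_le {X Y : Submodule F V} (h : ¬X ≤ Y) :
    finrank F (Y ⊓ X : Submodule F V) < finrank F X := by
  by_contra hlt
  exact h (inf_eq_right.1 (Submodule.eq_of_le_of_finrank_le inf_le_right (not_lt.1 hlt)))

theorem finrank_sup_eq_of_ne {t : ℕ} {δ X Y : Submodule F V} (hδ : finrank F δ = t)
    (hX : finrank F X = t + 1) (hY : finrank F Y = t + 1) (hδX : δ ≤ X) (hδY : δ ≤ Y)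
    (h : X ≠ Y) : finrank F (X ⊔ Y : Submodule F V) = t + 2 := by
  have h1 := Submodule.finrank_sup_add_finrank_inf_eq X Y
  have h2 : finrank F δ ≤ finrank F (X ⊓ Y : Submodule F V) :=
    Submodule.finrank_mono (le_inf hδX hδY)
  have h3 := finrank_inf_lt_of_not_le (X := Y) (Y := X)
    fun hle => h (Submodule.eq_of_le_of_finrank_le hle (by omega)).symm
  omega

theorem exists_le_finrank_eq [Finite F] (W : Submodule F V) {j : ℕ} (h : j ≤ finrank F W) :
    ∃ D ≤ W, finrank F D = j := by
  obtain ⟨E, h1, h2, -⟩ := exists_le_disjoint W ⊥ (j := j) (by rwa [inf_bot_eq, finrank_bot, zero_add])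
  exact ⟨E, h1, h2⟩

theorem IsMaxFamily.mem_of_isCover_le {t m : ℕ} {S : Set (Submodule F V)}
    (hS : IsMaxFamily t m S) {X C : Submodule F V} (hX : IsCover t S X) (hXC : X ≤ C)
    (hC : finrank F C = t + m) : C ∈ S :=
  hS.mem C hC fun A hA => (hX A hA).trans (Submodule.finrank_mono (inf_le_inf_left A hXC))

/-- Two (t+1)-spaces in a (t+2)-space meet in dimension at least t, so the right-hand side is itself
intersecting and maximality gives equality. -/
theorem IsMaxFamily.eq_core {t m : ℕ} {S : Set (Submodule F V)} (hS : IsMaxFamily t m S)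
    {Γ : Submodule F V} (hΓ : finrank F Γ = t + 2)
    (h : ∀ A ∈ S, t + 1 ≤ finrank F (A ⊓ Γ : Submodule F V)) :
    S = {A : Submodule F V | finrank F A = t + m ∧ t + 1 ≤ finrank F (A ⊓ Γ : Submodule F V)} := by
  refine hS.eq_of_subset (fun A hA => ⟨hS.finrank_eq A hA, h A hA⟩) (fun A hA => hA.1) ?_
  rintro A ⟨-, hA⟩ B ⟨-, hB⟩
  have h1 := finrank_add_le_of_le (inf_le_right : A ⊓ Γ ≤ Γ) (inf_le_right : B ⊓ Γ ≤ Γ)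
  have h2 : finrank F (A ⊓ Γ ⊓ (B ⊓ Γ) : Submodule F V) ≤ finrank F (A ⊓ B : Submodule F V) :=
    Submodule.finrank_mono (inf_le_inf inf_le_left inf_le_left)
  omega

/-- B ⊓ X has dimension at least t and does not contain the hyperplane δ of X, so together they span
X. The use is that every (t+1)-dimensional cover through δ lies in B ⊔ δ. -/
theorem inf_sup_eq_of_not_le {t : ℕ} {B X δ : Submodule F V} (hδ : finrank F δ = t)
    (hX : finrank F X = t + 1) (hδX : δ ≤ X) (hδB : ¬δ ≤ B)
    (hBX : t ≤ finrank F (B ⊓ X : Submodule F V)) : B ⊓ X ⊔ δ = X := by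
  refine Submodule.eq_of_le_of_finrank_le (sup_le inf_le_right hδX) ?_
  have h1 := Submodule.finrank_sup_add_finrank_inf_eq (B ⊓ X) δ
  have h2 := finrank_inf_lt_of_not_le hδB
  have h3 : finrank F (B ⊓ X ⊓ δ : Submodule F V) ≤ finrank F (B ⊓ δ : Submodule F V) :=
    Submodule.finrank_mono (inf_le_inf_right δ inf_le_left)
  omega

theorem finrank_inf_eq_of_not_le {t : ℕ} {B X δ : Submodule F V} (hδ : finrank F δ = t)
    (hX : finrank F X = t + 1) (hδX : δ ≤ X) (hδB : ¬δ ≤ B)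
    (hBX : t ≤ finrank F (B ⊓ X : Submodule F V)) :
    finrank F (B ⊓ δ : Submodule F V) + 1 = t := by
  have h1 := finrank_add_le_of_le (inf_le_right : B ⊓ X ≤ X) hδX
  have h2 := finrank_inf_lt_of_not_le hδB
  have h3 : finrank F (B ⊓ X ⊓ δ : Submodule F V) ≤ finrank F (B ⊓ δ : Submodule F V) :=
    Submodule.finrank_mono (inf_le_inf_right δ inf_le_left)
  omega

theorem IsMaxFamily.eq_span {t m : ℕ} {S : Set (Submodule F V)} (hS : IsMaxFamily t m S)
    (hm : 1 ≤ m) {δ B : Submodule F V} (hδ : finrank F δ = t) (hB : B ∈ S)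
    (hBδ : finrank F (B ⊓ δ : Submodule F V) + 1 = t)
    (h : ∀ A ∈ S, ¬δ ≤ A → A ≤ B ⊔ δ) :
    S = {A : Submodule F V | finrank F A = t + m ∧ A ≤ B ⊔ δ} ∪
      {A : Submodule F V | finrank F A = t + m ∧ δ ≤ A ∧ t + 1 ≤ finrank F (A ⊓ (B ⊔ δ) : Submodule F V)} := by
  have hBd := hS.finrank_eq B hB
  have hU := Submodule.finrank_sup_add_finrank_inf_eq B δ
  have hmix : ∀ C D : Submodule F V, finrank F C = t + m → C ≤ B ⊔ δ →
      t + 1 ≤ finrank F (D ⊓ (B ⊔ δ) : Submodule F V) →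
      t ≤ finrank F (C ⊓ D : Submodule F V) := by
    intro C D hC hCU hD
    have h1 := finrank_add_le_of_le hCU (inf_le_right : D ⊓ (B ⊔ δ) ≤ B ⊔ δ)
    have h2 : finrank F (C ⊓ (D ⊓ (B ⊔ δ)) : Submodule F V) ≤ finrank F (C ⊓ D : Submodule F V) :=
      Submodule.finrank_mono (inf_le_inf_left C inf_le_left)
    omega
  refine hS.eq_of_subset ?_ ?_ ?_
  · intro A hA
    by_cases hδA : δ ≤ A
    · refine Or.inr ⟨hS.finrank_eq A hA, hδA, ?_⟩
      -- A ⊓ B has dimension at least t but meets δ in dimension at most t-1, so adding δ yields at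
      -- least t+1.
      have h1 : A ⊓ B ⊔ δ ≤ A ⊓ (B ⊔ δ) :=
        sup_le (inf_le_inf_left A le_sup_left) (le_inf hδA le_sup_right)
      have h2 := Submodule.finrank_sup_add_finrank_inf_eq (A ⊓ B) δ
      have h3 := hS.le_finrank_inf A hA B hB
      have h4 : finrank F (A ⊓ B ⊓ δ : Submodule F V) ≤ finrank F (B ⊓ δ : Submodule F V) :=
        Submodule.finrank_mono (inf_le_inf_right δ inf_le_right)
      have h5 := Submodule.finrank_mono h1
      omega
    · exact Or.inl ⟨hS.finrank_eq A hA, h A hA hδA⟩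
  · rintro A (hA | hA)
    exacts [hA.1, hA.1]
  · rintro A (⟨hA, hAU⟩ | ⟨hA, hδA, hAU⟩) C (⟨hC, hCU⟩ | ⟨hC, hδC, hCU⟩)
    · have := finrank_add_le_of_le hAU hCU
      omega
    · exact hmix A C hA hAU hCU
    · rw [inf_comm]
      exact hmix C A hC hCU hAU
    · rw [← hδ]
      exact Submodule.finrank_mono (le_inf hδA hδC)

variable [Finite F]

/-- By maximality every (t+m)-space A through the cover X is a member. Since c > t, A can be chosen
to meet X ⊔ Y in X alone; then A ⊓ Y lies in X ⊓ Y, and the cover Y makes it large. -/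
theorem IsMaxFamily.le_finrank_inf_of_isCover {t m c : ℕ} {S : Set (Submodule F V)}
    (hS : IsMaxFamily t m S) (hV : finrank F V = t + m + c) (hm : 1 ≤ m) (hc : t < c)
    {X Y : Submodule F V} (hX : IsCover t S X) (hY : IsCover t S Y)
    (hXd : finrank F X = t + 1) (hYd : finrank F Y = t + 1) :
    t ≤ finrank F (X ⊓ Y : Submodule F V) := by
  have h1 := Submodule.finrank_sup_add_finrank_inf_eq X Y
  by_contra hlt
  have h2 : finrank F X ≤ finrank F (X ⊔ Y : Submodule F V) := Submodule.finrank_mono le_sup_left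
  obtain ⟨A, hA, hXA, hA'⟩ := exists_inf_eq (le_sup_left : X ≤ X ⊔ Y) (s := t + 1)
    (w := finrank F (X ⊔ Y : Submodule F V) - (t + 1)) (j := m - 1)
    (d := t + m + c - finrank F (X ⊔ Y : Submodule F V)) hXd (by omega)
    (by omega) (by omega)
  have h3 := hY A (hS.mem_of_isCover_le hX hXA (by omega))
  have h4 : A ⊓ Y ≤ X ⊓ Y := by
    refine le_inf ?_ inf_le_right
    conv_rhs => rw [← hA']
    exact inf_le_inf_left A le_sup_right
  exact hlt (h3.trans (Submodule.finrank_mono h4))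

/-- Spaces of dimension t+1 meeting pairwise in hyperplanes either share a hyperplane or lie in a
common (t+2)-space. In the second case three covers X, Y, Z with no common t-space suffice to
control all members. -/
theorem exists_center_or_exists_span {t : ℕ} {S 𝒯 : Set (Submodule F V)} (hne : 𝒯.Nonempty)
    (hc : ∀ X ∈ 𝒯, IsCover t S X) (hd : ∀ X ∈ 𝒯, finrank F X = t + 1)
    (hi : ∀ X ∈ 𝒯, ∀ Y ∈ 𝒯, t ≤ finrank F (X ⊓ Y : Submodule F V)) :
    (∃ δ : Submodule F V, finrank F δ = t ∧ ∀ X ∈ 𝒯, δ ≤ X) ∨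
      ∃ Γ : Submodule F V, finrank F Γ = t + 2 ∧
        ∀ A ∈ S, t + 1 ≤ finrank F (A ⊓ Γ : Submodule F V) := by
  obtain ⟨X, hX⟩ := hne
  by_cases h : ∀ Y ∈ 𝒯, Y = X
  · obtain ⟨δ, h1, h2⟩ := exists_le_finrank_eq X (by rw [hd X hX]; omega : t ≤ finrank F X)
    exact Or.inl ⟨δ, h2, fun Y hY => (h Y hY).symm ▸ h1⟩
  push Not at h
  obtain ⟨Y, hY, hYX⟩ := h
  have hXd := hd X hX
  have hYd := hd Y hY
  have hXY : finrank F (X ⊓ Y : Submodule F V) = t := by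
    refine le_antisymm ?_ (hi X hX Y hY)
    have := finrank_inf_lt_of_not_le (X := Y) (Y := X)
      fun hle => hYX (Submodule.eq_of_le_of_finrank_le hle (by omega))
    omega
  by_cases h : ∀ Z ∈ 𝒯, X ⊓ Y ≤ Z
  · exact Or.inl ⟨X ⊓ Y, hXY, h⟩
  push Not at h
  obtain ⟨Z, hZ, hXYZ⟩ := h
  have hZd := hd Z hZ
  have hlt := finrank_inf_lt_of_not_le hXYZ
  have hZle : Z ≤ X ⊔ Y := by
    have h1 := Submodule.finrank_sup_add_finrank_inf_eq (Z ⊓ X) (Z ⊓ Y)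
    have h2 : Z ⊓ X ⊓ (Z ⊓ Y) = Z ⊓ (X ⊓ Y) := by
      rw [inf_inf_inf_comm, inf_idem]
    rw [h2] at h1
    have h3 := hi Z hZ X hX
    have h4 := hi Z hZ Y hY
    have h5 : Z ⊓ X ⊔ Z ⊓ Y = Z :=
      Submodule.eq_of_le_of_finrank_le (sup_le inf_le_left inf_le_left) (by omega)
    rw [← h5]
    exact sup_le_sup inf_le_right inf_le_right
  refine Or.inr ⟨X ⊔ Y, ?_, fun A hA => ?_⟩
  · have := Submodule.finrank_sup_add_finrank_inf_eq X Y
    omega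
  -- If A met X ⊔ Y in dimension only t, this intersection would equal A ⊓ W for each of the three
  -- covers W, so it would lie in Z ⊓ (X ⊓ Y), whose dimension is below t.
  · by_contra hA'
    have key : ∀ W ∈ 𝒯, W ≤ X ⊔ Y → A ⊓ (X ⊔ Y) ≤ W := by
      intro W hW hle
      have : A ⊓ W = A ⊓ (X ⊔ Y) :=
        Submodule.eq_of_le_of_finrank_le (inf_le_inf_left A hle)
          (le_trans (by omega) (hc W hW A hA))
      rw [← this]
      exact inf_le_right
    have h1 : A ⊓ (X ⊔ Y) ≤ Z ⊓ (X ⊓ Y) :=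
      le_inf (key Z hZ hZle) (le_inf (key X hX le_sup_left) (key Y hY le_sup_right))
    have h2 := Submodule.finrank_mono h1
    have h3 : finrank F (A ⊓ X : Submodule F V) ≤ finrank F (A ⊓ (X ⊔ Y) : Submodule F V) :=
      Submodule.finrank_mono (inf_le_inf_left A le_sup_left)
    have h4 := hc X hX A hA
    omega

theorem IsMaxFamily.ncard_through_le {t m c : ℕ} {S : Set (Submodule F V)}
    (hS : IsMaxFamily t m S) (hV : finrank F V = t + m + c) {s : ℕ} {X : Submodule F V}
    (hX : finrank F X = t + s) (hs : s ≤ m) :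
    (({A | A ∈ S ∧ X ≤ A} : Set _).ncard : ℚ) ≤
      gaussBinom (Nat.card F) (m - s + c) (m - s) := by
  have : Finite V := Module.finite_of_finite F
  rw [← ncard_le hX (d := m - s + c) (by omega) (by omega)]
  exact_mod_cast Set.ncard_le_ncard (t := {A : Submodule F V | finrank F A = t + s + (m - s) ∧ X ≤ A})
    (fun A (hA : A ∈ S ∧ X ≤ A) => ⟨by rw [hS.finrank_eq A hA.1]; omega, hA.2⟩)
    (Set.toFinite _)

/-- The branching step is iterated j times; no space met on the way is large enough to be a cover.
-/
theorem IsMaxFamily.ncard_through_le_of_not_cover {t m c : ℕ} {S : Set (Submodule F V)}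
    (hS : IsMaxFamily t m S) (hV : finrank F V = t + m + c) (j : ℕ) :
    ∀ {s : ℕ} {X : Submodule F V}, finrank F X = t + s → s + j ≤ m →
      (∀ Y : Submodule F V, finrank F Y < t + s + j → ¬IsCover t S Y) →
      (({A | A ∈ S ∧ X ≤ A} : Set _).ncard : ℚ) ≤ gaussBinom (Nat.card F) (m + 1) 1 ^ j *
        gaussBinom (Nat.card F) (m - (s + j) + c) (m - (s + j)) := by
  induction j with
  | zero =>
    intro s X hX hs _
    rw [pow_zero, one_mul]
    exact hS.ncard_through_le hV hX hs
  | succ j ih =>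
    intro s X hX hs h
    have h1 := h X (by omega)
    simp only [IsCover, not_forall, not_le] at h1
    obtain ⟨B, hB, hBX⟩ := h1
    rw [pow_succ', mul_assoc]
    refine ncard_le_mul_of_not_cover S (hS.finrank_eq B hB) hBX
      (fun A hA => hS.le_finrank_inf A hA B hB) fun Y hXY hY => ?_
    have h2 := ih (s := s + 1) (X := Y) (by omega) (by omega) fun Z hZ => h Z (by omega)
    rwa [show s + 1 + j = s + (j + 1) by ring] at h2

theorem IsMaxFamily.ncard_le_of_isCover {t m c s : ℕ} {S : Set (Submodule F V)}
    (hS : IsMaxFamily t m S) (hV : finrank F V = t + m + c) {X : Submodule F V}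
    (hX : finrank F X = t + s) (hs : s ≤ m) (hXc : IsCover t S X)
    (h : ∀ Y : Submodule F V, finrank F Y < t + s → ¬IsCover t S Y) :
    (S.ncard : ℚ) ≤ gaussBinom (Nat.card F) (t + s) t *
      (gaussBinom (Nat.card F) (m + 1) 1 ^ s * gaussBinom (Nat.card F) (m - s + c) (m - s)) := by
  have : Finite V := Module.finite_of_finite F
  rw [← ncard_ge hX (Nat.le_add_right t s)]
  refine ncard_le_mul (f := fun D => {A | A ∈ S ∧ D ≤ A}) ?_ ?_
  · intro A hA
    obtain ⟨D, h1, h2⟩ := exists_le_finrank_eq (A ⊓ X) (hXc A hA)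
    exact ⟨D, ⟨h2, h1.trans inf_le_right⟩, hA, h1.trans inf_le_left⟩
  · rintro D ⟨hD, -⟩
    have := hS.ncard_through_le_of_not_cover hV s (s := 0) (X := D) hD (by omega)
      (by simpa using h)
    rwa [zero_add] at this

end Subspaces

/-! ### Families whose small covers share a centre -/

section Subspaces

variable {F V : Type*} [Field F] [AddCommGroup V] [Module F V] [Module.Finite F V] [Finite F]

/-- Branch from δ along a transversal E of a member missing δ. Points of E in U may give covers and
are bounded trivially, but as U is small there are at most [m,1] of them. Any other point gives a
non-cover, where a second branching applies. -/
theorem IsMaxFamily.ncard_through_center_le {t m c : ℕ} {S : Set (Submodule F V)}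
    (hS : IsMaxFamily t m S) (hV : finrank F V = t + m + c) (hm : 2 ≤ m)
    {δ U B : Submodule F V} (hδ : finrank F δ = t) (hB : B ∈ S) (hδB : ¬δ ≤ B) (hδU : δ ≤ U)
    (hU : finrank F U ≤ t + m)
    (hcov : ∀ X : Submodule F V, finrank F X = t + 1 → IsCover t S X → X ≤ U)
    (hle : gaussBinom (Nat.card F) (m + 1) 1 * gaussBinom (Nat.card F) (m - 2 + c) (m - 2) ≤
      gaussBinom (Nat.card F) (m - 1 + c) (m - 1)) :
    (({A | A ∈ S ∧ δ ≤ A} : Set _).ncard : ℚ) ≤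
      gaussBinom (Nat.card F) m 1 * gaussBinom (Nat.card F) (m - 1 + c) (m - 1) +
        (gaussBinom (Nat.card F) (m + 1) 1 - gaussBinom (Nat.card F) m 1) *
        (gaussBinom (Nat.card F) (m + 1) 1 * gaussBinom (Nat.card F) (m - 2 + c) (m - 2)) := by
  have : Finite V := Module.finite_of_finite F
  have hlt := finrank_inf_lt_of_not_le hδB
  rw [hδ] at hlt
  obtain ⟨E, -, hEd, hEδ, hE⟩ := exists_transversal (hS.finrank_eq B hB) hlt
  set I : Set (Submodule F V) := {P | finrank F P = 1 ∧ P ≤ E} with hI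
  set J : Set (Submodule F V) := {P | finrank F P = 1 ∧ P ≤ E ⊓ U} with hJ
  have hJI : J ⊆ I := fun P hP => ⟨hP.1, hP.2.trans inf_le_left⟩
  have hIc : (I.ncard : ℚ) = gaussBinom (Nat.card F) (m + 1) 1 := ncard_ge hEd (by omega)
  have hJc : (J.ncard : ℚ) ≤ gaussBinom (Nat.card F) m 1 := by
    have h1 := finrank_sup_of_disjoint (hEδ.mono_left (inf_le_left : E ⊓ U ≤ E))
    have h2 : finrank F (E ⊓ U ⊔ δ : Submodule F V) ≤ finrank F U :=
      Submodule.finrank_mono (sup_le inf_le_right hδU)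
    obtain ⟨D, hD, hDm⟩ := exists_le_finrank_eq E (by omega : m ≤ finrank F E)
    have hq : 1 < Nat.card F := Finite.one_lt_card
    have hq1 : (1 : ℚ) < Nat.card F := by exact_mod_cast hq
    by_cases h0 : finrank F (E ⊓ U : Submodule F V) = 0
    · have : J = ∅ := by
        refine Set.eq_empty_iff_forall_notMem.2 fun P hP => ?_
        have := Submodule.finrank_mono hP.2
        rw [hP.1, h0] at this
        omega
      rw [this, Set.ncard_empty, Nat.cast_zero]
      exact (gaussBinom_pos hq (by omega)).le
    · rw [ncard_ge rfl (by omega), gaussBinom_one_right, gaussBinom_one_right]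
      have : 0 ≤ (Nat.card F : ℚ) - 1 := by linarith
      gcongr
      · exact hq1.le
      · omega
  have hsub : {A | A ∈ S ∧ δ ≤ A} ⊆ {A | (A ∈ S ∧ δ ≤ A) ∧ ∃ P ∈ J, P ≤ A} ∪
      {A | (A ∈ S ∧ δ ≤ A) ∧ ∃ P ∈ I \ J, P ≤ A} := by
    intro A hA
    obtain ⟨P, hP, hPA⟩ := hE A (hS.le_finrank_inf A hA.1 B hB)
    by_cases hPJ : P ∈ J
    exacts [Or.inl ⟨hA, P, hPJ, hPA⟩, Or.inr ⟨hA, P, ⟨hP, hPJ⟩, hPA⟩]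
  have hdim : ∀ P ∈ I, finrank F (δ ⊔ P : Submodule F V) = t + 1 := by
    intro P hP
    rw [finrank_sup_of_disjoint (hEδ.symm.mono_right hP.2), hδ, hP.1]
  have h1 : (({A | (A ∈ S ∧ δ ≤ A) ∧ ∃ P ∈ J, P ≤ A} : Set _).ncard : ℚ) ≤
      J.ncard * gaussBinom (Nat.card F) (m - 1 + c) (m - 1) := by
    refine ncard_le_mul (f := fun P => {A | A ∈ S ∧ δ ⊔ P ≤ A}) ?_ fun P hP => ?_
    · rintro A ⟨⟨hA, hδA⟩, P, hP, hPA⟩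
      exact ⟨P, hP, hA, sup_le hδA hPA⟩
    · exact hS.ncard_through_le hV (hdim P (hJI hP)) (by omega)
  have h2 : (({A | (A ∈ S ∧ δ ≤ A) ∧ ∃ P ∈ I \ J, P ≤ A} : Set _).ncard : ℚ) ≤
      (I \ J).ncard * (gaussBinom (Nat.card F) (m + 1) 1 *
        gaussBinom (Nat.card F) (m - 2 + c) (m - 2)) := by
    refine ncard_le_mul (f := fun P => {A | A ∈ S ∧ δ ⊔ P ≤ A}) ?_ fun P hP => ?_
    · rintro A ⟨⟨hA, hδA⟩, P, hP, hPA⟩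
      exact ⟨P, hP, hA, sup_le hδA hPA⟩
    · have hnc : ¬IsCover t S (δ ⊔ P) := fun hc => hP.2 ⟨hP.1.1,
        le_inf hP.1.2 (le_sup_right.trans (hcov _ (hdim P hP.1) hc))⟩
      simp only [IsCover, not_forall, not_le] at hnc
      obtain ⟨D, hD, hDX⟩ := hnc
      refine ncard_le_mul_of_not_cover S (hS.finrank_eq D hD) hDX
        (fun A hA => hS.le_finrank_inf A hA D hD) fun Y _ hY => ?_
      exact hS.ncard_through_le hV (hY.trans (by rw [hdim P hP.1])) hm
  have h3 : ((I \ J).ncard : ℚ) = I.ncard - J.ncard := by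
    rw [← Set.ncard_sdiff_add_ncard_of_subset hJI]
    push_cast
    ring
  have h4 : (({A | A ∈ S ∧ δ ≤ A} : Set _).ncard : ℚ) ≤ _ :=
    Nat.cast_le.2 ((Set.ncard_le_ncard hsub (Set.toFinite _)).trans (Set.ncard_union_le _ _))
  push_cast at h4
  rw [h3, hIc] at h2
  -- By `hle` a point of J costs at least as much as one outside J, so the bound increases with the
  -- size of J, which may be replaced by [m,1].
  nlinarith [mul_le_mul_of_nonneg_right hJc (sub_nonneg.2 hle)]

/-- A member not through δ contains a t-subspace D of X other than δ. Two branchings from D are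
possible: D is no cover, and an extension of D is either through δ, hence in no such member, or
again no cover. -/
theorem IsMaxFamily.ncard_not_through_center_le {t m c : ℕ} {S : Set (Submodule F V)}
    (hS : IsMaxFamily t m S) (hV : finrank F V = t + m + c) (hm : 2 ≤ m)
    {δ X : Submodule F V} (hδ : finrank F δ = t) (hδX : δ ≤ X) (hX : finrank F X = t + 1)
    (hXc : IsCover t S X) (h0 : ∀ Y : Submodule F V, finrank F Y = t → ¬IsCover t S Y)
    (hcov : ∀ Y : Submodule F V, finrank F Y = t + 1 → IsCover t S Y → δ ≤ Y) :
    (({A | A ∈ S ∧ ¬δ ≤ A} : Set _).ncard : ℚ) ≤ (gaussBinom (Nat.card F) (t + 1) 1 - 1) *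
      (gaussBinom (Nat.card F) (m + 1) 1 * (gaussBinom (Nat.card F) (m + 1) 1 *
        gaussBinom (Nat.card F) (m - 2 + c) (m - 2))) := by
  have : Finite V := Module.finite_of_finite F
  have hq : 2 ≤ Nat.card F := Finite.one_lt_card
  have hI : (({D : Submodule F V | finrank F D = t ∧ D ≤ X} \ {δ}).ncard : ℚ) =
      gaussBinom (Nat.card F) (t + 1) 1 - 1 := by
    have hδI : δ ∈ {D : Submodule F V | finrank F D = t ∧ D ≤ X} := ⟨hδ, hδX⟩
    rw [← gaussBinom_succ_self hq, ← ncard_ge hX (Nat.le_succ t),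
      ← Set.ncard_sdiff_singleton_add_one hδI (Set.toFinite _)]
    push_cast
    ring
  have hpos : 0 ≤ gaussBinom (Nat.card F) (m + 1) 1 *
        gaussBinom (Nat.card F) (m - 2 + c) (m - 2) :=
    mul_nonneg (gaussBinom_pos hq (by omega)).le (gaussBinom_pos hq (by omega)).le
  rw [← hI]
  refine ncard_le_mul (f := fun D => {A | A ∈ {A | A ∈ S ∧ ¬δ ≤ A} ∧ D ≤ A}) ?_ ?_
  · rintro A ⟨hA, hδA⟩
    obtain ⟨D, h1, h2⟩ := exists_le_finrank_eq (A ⊓ X) (hXc A hA)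
    refine ⟨D, ⟨⟨h2, h1.trans inf_le_right⟩, ?_⟩, ⟨hA, hδA⟩, h1.trans inf_le_left⟩
    rintro rfl
    exact hδA (h1.trans inf_le_left)
  · rintro D ⟨⟨hD, -⟩, -⟩
    have hnc := h0 D hD
    simp only [IsCover, not_forall, not_le] at hnc
    obtain ⟨B, hB, hBD⟩ := hnc
    refine ncard_le_mul_of_not_cover _ (hS.finrank_eq B hB) hBD
      (fun A hA => hS.le_finrank_inf A hA.1 B hB) fun Y _ hY => ?_
    rw [hD] at hY
    by_cases hδY : δ ≤ Y
    · have : {A | A ∈ {A | A ∈ S ∧ ¬δ ≤ A} ∧ Y ≤ A} = ∅ :=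
        Set.eq_empty_iff_forall_notMem.2 fun A hA => hA.1.2 (hδY.trans hA.2)
      rw [this, Set.ncard_empty, Nat.cast_zero]
      exact hpos
    have hnc : ¬IsCover t S Y := fun hc => hδY (hcov Y hY hc)
    simp only [IsCover, not_forall, not_le] at hnc
    obtain ⟨C, hC, hCY⟩ := hnc
    refine ncard_le_mul_of_not_cover _ (hS.finrank_eq C hC) hCY
      (fun A hA => hS.le_finrank_inf A hA.1 C hC) fun Z _ hZ => ?_
    refine le_trans ?_ (hS.ncard_through_le hV (hZ.trans (by rw [hY])) hm)
    exact_mod_cast Set.ncard_le_ncard (t := {A | A ∈ S ∧ Z ≤ A})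
      (fun A (hA : (A ∈ S ∧ ¬δ ≤ A) ∧ Z ≤ A) => ⟨hA.1.1, hA.2⟩) (Set.toFinite _)

end Subspaces

/-! ### Sizes of the two extremal examples -/

theorem cast_ncard_sdiff {α : Type*} [Finite α] {s t : Set α} (h : s ⊆ t) :
    ((t \ s).ncard : ℚ) = t.ncard - s.ncard := by
  rw [← Set.ncard_sdiff_add_ncard_of_subset h]
  push_cast
  ring

/-- Bonferroni's inequality, with the number of pairs weakened to the square of the number of sets.
-/
theorem le_ncard_biUnion {α ι : Type*} [Finite α] [Finite ι] (f : ι → Set α) {L M : ℚ} (hM : 0 ≤ M)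
    (I : Finset ι) (hL : ∀ i ∈ I, L ≤ (f i).ncard)
    (hLM : ∀ i ∈ I, ∀ j ∈ I, i ≠ j → ((f i ∩ f j).ncard : ℚ) ≤ M) :
    I.card * L - (I.card : ℚ) ^ 2 * M ≤ (⋃ i ∈ I, f i).ncard := by
  classical
  induction I using Finset.induction_on with
  | empty => simp
  | insert i J hi ih =>
    have h1 := ih (fun j hj => hL j (Finset.mem_insert_of_mem hj)) fun j hj k hk =>
      hLM j (Finset.mem_insert_of_mem hj) k (Finset.mem_insert_of_mem hk)
    have h2 := Set.ncard_union_add_ncard_inter (f i) (⋃ j ∈ J, f j)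
    have h3 : ((f i ∩ ⋃ j ∈ J, f j).ncard : ℚ) ≤ J.card * M := by
      rw [← Set.ncard_coe_finset]
      refine ncard_le_mul (f := fun j => f i ∩ f j) ?_ fun j hj => ?_
      · rintro a ⟨ha, haJ⟩
        simp only [Set.mem_iUnion] at haJ
        obtain ⟨j, hj, haj⟩ := haJ
        exact ⟨j, by simpa using hj, ha, haj⟩
      · have hj' : j ∈ J := by simpa using hj
        exact hLM i (Finset.mem_insert_self i J) j (Finset.mem_insert_of_mem hj')
          fun h => hi (h ▸ hj')
    have h4 := hL i (Finset.mem_insert_self i J)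
    have h5 : ((f i ∪ ⋃ j ∈ J, f j).ncard : ℚ) + (f i ∩ ⋃ j ∈ J, f j).ncard =
      (f i).ncard + (⋃ j ∈ J, f j).ncard := by exact_mod_cast h2
    rw [Finset.set_biUnion_insert, Finset.card_insert_of_notMem hi]
    push_cast
    nlinarith [mul_nonneg (Nat.cast_nonneg (α := ℚ) J.card) hM]

section Subspaces

variable {F V : Type*} [Field F] [AddCommGroup V] [Module F V] [Module.Finite F V] [Finite F]

/-- Members either contain Γ or are sorted by the hyperplane A ⊓ Γ of Γ. -/
theorem ncard_core {t m c : ℕ} (hV : finrank F V = t + m + c) (hm : 2 ≤ m)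
    {Γ : Submodule F V} (hΓ : finrank F Γ = t + 2) :
    ({A : Submodule F V | finrank F A = t + m ∧
      t + 1 ≤ finrank F (A ⊓ Γ : Submodule F V)}.ncard : ℚ) =
      gaussBinom (Nat.card F) (t + 2) 1 * (gaussBinom (Nat.card F) (m - 1 + c) (m - 1) -
        gaussBinom (Nat.card F) (m - 2 + c) (m - 2)) +
        gaussBinom (Nat.card F) (m - 2 + c) (m - 2) := by
  have : Finite V := Module.finite_of_finite F
  have hq : 2 ≤ Nat.card F := Finite.one_lt_card
  set T : Set (Submodule F V) := {A | finrank F A = t + m ∧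
    t + 1 ≤ finrank F (A ⊓ Γ : Submodule F V)} with hT
  have hΓset : ({A : Submodule F V | finrank F A = t + m ∧ Γ ≤ A}.ncard : ℚ) =
      gaussBinom (Nat.card F) (m - 2 + c) (m - 2) := by
    rw [← ncard_le hΓ (by omega : finrank F V = t + 2 + (m - 2 + c)) (by omega),
      show t + 2 + (m - 2) = t + m by omega]
  have hsub : {A : Submodule F V | finrank F A = t + m ∧ Γ ≤ A} ⊆ T := by
    rintro A ⟨hA, hΓA⟩
    refine ⟨hA, ?_⟩
    rw [inf_eq_right.2 hΓA, hΓ]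
    omega
  have h1 := cast_ncard_sdiff hsub
  have hI : ({H : Submodule F V | finrank F H = t + 1 ∧ H ≤ Γ}.ncard : ℚ) =
      gaussBinom (Nat.card F) (t + 2) 1 := by
    rw [ncard_ge hΓ (by omega)]
    exact gaussBinom_succ_self hq (t + 1)
  have h2 : ((T \ {A : Submodule F V | finrank F A = t + m ∧ Γ ≤ A}).ncard : ℚ) =
      gaussBinom (Nat.card F) (t + 2) 1 * (gaussBinom (Nat.card F) (m - 1 + c) (m - 1) -
        gaussBinom (Nat.card F) (m - 2 + c) (m - 2)) := by
    rw [← hI]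
    have hinf : ∀ A : Submodule F V, ¬Γ ≤ A → finrank F (A ⊓ Γ : Submodule F V) ≤ t + 1 := by
      intro A hA
      have := finrank_inf_lt_of_not_le hA
      omega
    refine ncard_eq_mul (fun A => A ⊓ Γ) ?_ ?_
    · rintro A ⟨⟨hA, hAΓ⟩, hnot⟩
      exact ⟨le_antisymm (hinf A fun h => hnot ⟨hA, h⟩) hAΓ, inf_le_right⟩
    · rintro H ⟨hH, hHΓ⟩
      have hHset : ({A : Submodule F V | finrank F A = t + m ∧ H ≤ A}.ncard : ℚ) =
          gaussBinom (Nat.card F) (m - 1 + c) (m - 1) := by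
        rw [← ncard_le hH (by omega : finrank F V = t + 1 + (m - 1 + c)) (by omega),
          show t + 1 + (m - 1) = t + m by omega]
      have hsub' : {A : Submodule F V | finrank F A = t + m ∧ Γ ≤ A} ⊆
          {A : Submodule F V | finrank F A = t + m ∧ H ≤ A} :=
        fun A hA => ⟨hA.1, hHΓ.trans hA.2⟩
      rw [← hHset, ← hΓset, ← cast_ncard_sdiff hsub']
      congr 2
      ext A
      constructor
      · rintro ⟨⟨⟨hA, -⟩, hnot⟩, rfl⟩
        exact ⟨⟨hA, inf_le_left⟩, hnot⟩
      · rintro ⟨⟨hA, hHA⟩, hnot⟩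
        have hle : H ≤ A ⊓ Γ := le_inf hHA hHΓ
        have h3 := Submodule.finrank_mono hle
        refine ⟨⟨⟨hA, by omega⟩, hnot⟩, ?_⟩
        refine (Submodule.eq_of_le_of_finrank_le hle ?_).symm
        rw [hH]
        exact hinf A fun h => hnot ⟨hA, h⟩
  rw [h2, hΓset] at h1
  linarith

/-- The hyperplanes of U through δ belong to both parts of the example; removing them from the first
part makes the union disjoint. -/
theorem ncard_span {t m : ℕ} (hm : 2 ≤ m)
    {δ U : Submodule F V} (hδ : finrank F δ = t) (hU : finrank F U = t + m + 1) (hδU : δ ≤ U) :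
    (({A : Submodule F V | finrank F A = t + m ∧ A ≤ U} ∪
      {A : Submodule F V | finrank F A = t + m ∧ δ ≤ A ∧
        t + 1 ≤ finrank F (A ⊓ U : Submodule F V)}).ncard : ℚ) =
      gaussBinom (Nat.card F) (t + m + 1) 1 - gaussBinom (Nat.card F) (m + 1) 1 +
        ({A : Submodule F V | finrank F A = t + m ∧ δ ≤ A ∧ A ⊓ U ≠ δ}.ncard : ℚ) := by
  have : Finite V := Module.finite_of_finite F
  have hq : 2 ≤ Nat.card F := Finite.one_lt_card
  have h1 : ({A : Submodule F V | finrank F A = t + m ∧ A ≤ U}.ncard : ℚ) =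
      gaussBinom (Nat.card F) (t + m + 1) 1 := by
    rw [ncard_ge hU (by omega), gaussBinom_succ_self hq]
  have h2 : ({A : Submodule F V | finrank F A = t + m ∧ δ ≤ A ∧ A ≤ U}.ncard : ℚ) =
      gaussBinom (Nat.card F) (m + 1) 1 := by
    rw [ncard_interval hδU hδ (d := m + 1) (by omega) (by omega), gaussBinom_succ_self hq]
  have hsub : {A : Submodule F V | finrank F A = t + m ∧ δ ≤ A ∧ A ≤ U} ⊆
      {A : Submodule F V | finrank F A = t + m ∧ A ≤ U} := fun A hA => ⟨hA.1, hA.2.2⟩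
  rw [← h1, ← h2, ← cast_ncard_sdiff hsub, ← Nat.cast_add, ← Set.ncard_union_eq]
  · congr 2
    ext A
    have key : δ ≤ A → (t + 1 ≤ finrank F (A ⊓ U : Submodule F V) ↔ A ⊓ U ≠ δ) := by
      intro hδA
      have hle : δ ≤ A ⊓ U := le_inf hδA hδU
      constructor
      · rintro h rfl
        omega
      · intro h
        by_contra hlt
        exact h (Submodule.eq_of_le_of_finrank_le hle (by omega)).symm
    have hU' : finrank F A = t + m → A ≤ U → δ ≤ A → A ⊓ U ≠ δ := by
      intro hA hAU hδA heq
      rw [inf_eq_left.2 hAU] at heq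
      rw [heq] at hA
      omega
    change (finrank F A = t + m ∧ A ≤ U) ∨ (finrank F A = t + m ∧ δ ≤ A ∧
      t + 1 ≤ finrank F (A ⊓ U : Submodule F V)) ↔ ((finrank F A = t + m ∧ A ≤ U) ∧
      ¬(finrank F A = t + m ∧ δ ≤ A ∧ A ≤ U)) ∨ (finrank F A = t + m ∧ δ ≤ A ∧ A ⊓ U ≠ δ)
    by_cases hδA : δ ≤ A
    · rw [key hδA]
      tauto
    · tauto
  · rw [Set.disjoint_left]
    rintro A ⟨⟨hA, hAU⟩, hnot⟩ ⟨-, hδA, -⟩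
    exact hnot ⟨hA, hδA, hAU⟩

theorem ncard_inf_ne {t m c : ℕ} (hV : finrank F V = t + m + c) (hm : 2 ≤ m) (hc : m < c)
    {δ U : Submodule F V} (hδ : finrank F δ = t) (hU : finrank F U = t + m + 1) (hδU : δ ≤ U) :
    ({A : Submodule F V | finrank F A = t + m ∧ δ ≤ A ∧ A ⊓ U ≠ δ}.ncard : ℚ) =
      gaussBinom (Nat.card F) (m + c) m -
        (Nat.card F : ℚ) ^ ((m + 1) * m) * gaussBinom (Nat.card F) (c - 1) m := by
  have : Finite V := Module.finite_of_finite F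
  have hsub : {A : Submodule F V | finrank F A = t + m ∧ δ ≤ A ∧ A ⊓ U = δ} ⊆
      {A : Submodule F V | finrank F A = t + m ∧ δ ≤ A} := fun A hA => ⟨hA.1, hA.2.1⟩
  rw [← ncard_inf_eq hδU hδ (w := m + 1) (d := c - 1) (by omega) (by omega) (by omega),
    ← ncard_le hδ (by omega : finrank F V = t + (m + c)) (by omega), ← cast_ncard_sdiff hsub]
  congr 2
  ext A
  change _ ∧ _ ∧ _ ↔ (_ ∧ _) ∧ ¬(_ ∧ _ ∧ _)
  tauto

theorem exists_between_of_inf_ne {t : ℕ} {δ U A : Submodule F V} (hδ : finrank F δ = t)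
    (hδU : δ ≤ U) (hδA : δ ≤ A) (h : A ⊓ U ≠ δ) :
    ∃ X : Submodule F V, (finrank F X = t + 1 ∧ δ ≤ X ∧ X ≤ U) ∧ X ≤ A := by
  have hle : δ ≤ A ⊓ U := le_inf hδA hδU
  have hlt := Submodule.finrank_lt_finrank_of_lt (lt_of_le_of_ne hle h.symm)
  obtain ⟨P, hP, hP1, hPδ⟩ := exists_le_disjoint (A ⊓ U) δ (j := 1)
    (by rw [inf_eq_right.2 hle]; omega)
  refine ⟨δ ⊔ P, ⟨?_, le_sup_left, sup_le hδU (hP.trans inf_le_right)⟩,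
    sup_le hδA (hP.trans inf_le_left)⟩
  rw [finrank_sup_of_disjoint hPδ.symm, hδ, hP1]

theorem ncard_finrank_and_le {t m c s : ℕ} (hV : finrank F V = t + m + c) (hs : s ≤ m)
    {X : Submodule F V} (hX : finrank F X = t + s) :
    ({A : Submodule F V | finrank F A = t + m ∧ X ≤ A}.ncard : ℚ) =
      gaussBinom (Nat.card F) (m - s + c) (m - s) := by
  rw [← ncard_le hX (by omega : finrank F V = t + s + (m - s + c)) (by omega),
    show t + s + (m - s) = t + m by omega]

/-- Bonferroni over the [m+1,1] points X of U/δ: two of them span a (t+2)-space, which gives the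
pairwise term. -/
theorem le_ncard_inf_ne {t m c : ℕ} (hV : finrank F V = t + m + c) (hm : 2 ≤ m)
    {δ U : Submodule F V} (hδ : finrank F δ = t) (hU : finrank F U = t + m + 1) (hδU : δ ≤ U) :
    gaussBinom (Nat.card F) (m + 1) 1 * gaussBinom (Nat.card F) (m - 1 + c) (m - 1) -
      gaussBinom (Nat.card F) (m + 1) 1 ^ 2 * gaussBinom (Nat.card F) (m - 2 + c) (m - 2) ≤
    ({A : Submodule F V | finrank F A = t + m ∧ δ ≤ A ∧ A ⊓ U ≠ δ}.ncard : ℚ) := by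
  have : Finite V := Module.finite_of_finite F
  have hq : 2 ≤ Nat.card F := Finite.one_lt_card
  set I : Set (Submodule F V) := {X | finrank F X = t + 1 ∧ δ ≤ X ∧ X ≤ U} with hI
  have hIc : (I.ncard : ℚ) = gaussBinom (Nat.card F) (m + 1) 1 :=
    ncard_interval hδU hδ (d := m + 1) (by omega) (by omega)
  rw [Set.ncard_eq_toFinset_card I (Set.toFinite I)] at hIc
  have h := le_ncard_biUnion (fun X : Submodule F V => {A : Submodule F V | finrank F A = t + m ∧ X ≤ A})
    (gaussBinom_pos hq (Nat.le_add_right (m - 2) c)).le (Set.toFinite I).toFinset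
    (L := gaussBinom (Nat.card F) (m - 1 + c) (m - 1)) ?_ ?_
  · rw [hIc] at h
    refine h.trans ?_
    norm_cast
    refine Set.ncard_le_ncard ?_ (Set.toFinite _)
    intro A hA
    simp only [Set.mem_iUnion] at hA
    obtain ⟨X, hX, hA, hXA⟩ := hA
    have hX : X ∈ I := by simpa using hX
    refine ⟨hA, hX.2.1.trans hXA, fun heq => ?_⟩
    have := Submodule.finrank_mono (le_inf hXA hX.2.2)
    rw [heq, hX.1] at this
    omega
  · intro X hX
    have hX : X ∈ I := by simpa using hX
    exact (ncard_finrank_and_le hV (by omega) hX.1).ge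
  · intro X hX Y hY hXY
    have hX : X ∈ I := by simpa using hX
    have hY : Y ∈ I := by simpa using hY
    rw [← ncard_finrank_and_le hV hm (finrank_sup_eq_of_ne hδ hX.1 hY.1 hX.2.1 hY.2.1 hXY)]
    exact_mod_cast Set.ncard_le_ncard (t := {A : Submodule F V | finrank F A = t + m ∧ X ⊔ Y ≤ A})
      (fun A (hA : (finrank F A = t + m ∧ X ≤ A) ∧ (finrank F A = t + m ∧ Y ≤ A)) => ⟨hA.1.1, sup_le hA.1.2 hA.2.2⟩) (Set.toFinite _)

theorem ncard_inf_ne_le {t m c : ℕ} (hV : finrank F V = t + m + c) (hm : 2 ≤ m)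
    {δ U : Submodule F V} (hδ : finrank F δ = t) (hU : finrank F U = t + m + 1) (hδU : δ ≤ U) :
    ({A : Submodule F V | finrank F A = t + m ∧ δ ≤ A ∧ A ⊓ U ≠ δ}.ncard : ℚ) ≤
    gaussBinom (Nat.card F) (m + 1) 1 * gaussBinom (Nat.card F) (m - 1 + c) (m - 1) := by
  have : Finite V := Module.finite_of_finite F
  rw [← ncard_interval hδU hδ (d := m + 1) (by omega) (by omega : 1 ≤ m + 1)]
  refine ncard_le_mul (f := fun X => {A : Submodule F V | finrank F A = t + m ∧ X ≤ A}) ?_ fun X hX => ?_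
  · rintro A ⟨hA, hδA, hne⟩
    obtain ⟨X, hX, hXA⟩ := exists_between_of_inf_ne hδ hδU hδA hne
    exact ⟨X, hX, hA, hXA⟩
  · exact (ncard_finrank_and_le hV (by omega) hX.1).le

theorem exists_three_between {t : ℕ} {δ U : Submodule F V} (hδ : finrank F δ = t)
    (hU : t + 3 ≤ finrank F U) (hδU : δ ≤ U) :
    ∃ X Y Z : Submodule F V, (finrank F X = t + 1 ∧ δ ≤ X ∧ X ≤ U) ∧
      (finrank F Y = t + 1 ∧ δ ≤ Y ∧ Y ≤ U) ∧ (finrank F Z = t + 1 ∧ δ ≤ Z ∧ Z ≤ U) ∧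
      finrank F (X ⊔ Y ⊔ Z : Submodule F V) = t + 3 := by
  obtain ⟨P, hP, hP1, hPd⟩ := exists_le_disjoint U δ (j := 1)
    (by rw [inf_eq_right.2 hδU]; omega)
  have hX := finrank_sup_of_disjoint hPd.symm
  have hXU : δ ⊔ P ≤ U := sup_le hδU hP
  obtain ⟨Q, hQ, hQ1, hQd⟩ := exists_le_disjoint U (δ ⊔ P) (j := 1)
    (by rw [inf_eq_right.2 hXU]; omega)
  have hXY := finrank_sup_of_disjoint hQd.symm
  have hXYU : δ ⊔ P ⊔ Q ≤ U := sup_le hXU hQ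
  obtain ⟨R, hR, hR1, hRd⟩ := exists_le_disjoint U (δ ⊔ P ⊔ Q) (j := 1)
    (by rw [inf_eq_right.2 hXYU]; omega)
  have hXYZ := finrank_sup_of_disjoint hRd.symm
  have hY := finrank_sup_of_disjoint (hQd.symm.mono_left (le_sup_left : δ ≤ δ ⊔ P))
  have hZ := finrank_sup_of_disjoint
    (hRd.symm.mono_left ((le_sup_left.trans le_sup_left : δ ≤ δ ⊔ P ⊔ Q)))
  refine ⟨δ ⊔ P, δ ⊔ Q, δ ⊔ R, ⟨by omega, le_sup_left, hXU⟩,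
    ⟨by omega, le_sup_left, sup_le hδU hQ⟩, ⟨by omega, le_sup_left, sup_le hδU hR⟩, ?_⟩
  have : δ ⊔ P ⊔ (δ ⊔ Q) ⊔ (δ ⊔ R) = δ ⊔ P ⊔ Q ⊔ R := by
    apply le_antisymm
    · refine sup_le (sup_le ?_ (sup_le ?_ ?_)) (sup_le ?_ le_sup_right)
      · exact le_sup_left.trans le_sup_left
      · exact le_sup_left.trans (le_sup_left.trans le_sup_left)
      · exact le_sup_right.trans le_sup_left
      · exact le_sup_left.trans (le_sup_left.trans le_sup_left)
    · refine sup_le (sup_le (sup_le ?_ ?_) ?_) ?_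
      · exact le_sup_left.trans (le_sup_left.trans le_sup_left)
      · exact le_sup_right.trans (le_sup_left.trans le_sup_left)
      · exact le_sup_right.trans (le_sup_right.trans le_sup_left)
      · exact le_sup_right.trans le_sup_right
  rw [this]
  omega

/-- A union bound sharpened to second order, for the case m = t+1. Every point of U/δ other than X
discards its overlap with X, and Y also discards its overlap with a third independent point Z. -/
theorem ncard_inf_ne_le_sub {t m c : ℕ} (hV : finrank F V = t + m + c) (hm : 3 ≤ m)
    {δ U : Submodule F V} (hδ : finrank F δ = t) (hU : finrank F U = t + m + 1) (hδU : δ ≤ U) :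
    ({A : Submodule F V | finrank F A = t + m ∧ δ ≤ A ∧ A ⊓ U ≠ δ}.ncard : ℚ) ≤
    gaussBinom (Nat.card F) (m - 1 + c) (m - 1) + (gaussBinom (Nat.card F) (m + 1) 1 - 1) *
      (gaussBinom (Nat.card F) (m - 1 + c) (m - 1) - gaussBinom (Nat.card F) (m - 2 + c) (m - 2)) -
      (gaussBinom (Nat.card F) (m - 2 + c) (m - 2) -
        gaussBinom (Nat.card F) (m - 3 + c) (m - 3)) := by
  have : Finite V := Module.finite_of_finite F
  obtain ⟨X, Y, Z, hX, hY, hZ, hXYZ⟩ := exists_three_between hδ (by omega) hδU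
  set I : Set (Submodule F V) := {X | finrank F X = t + 1 ∧ δ ≤ X ∧ X ≤ U} with hI
  have hIc : (I.ncard : ℚ) = gaussBinom (Nat.card F) (m + 1) 1 :=
    ncard_interval hδU hδ (d := m + 1) (by omega) (by omega)
  set f : Submodule F V → Set (Submodule F V) := fun X => {A : Submodule F V | finrank F A = t + m ∧ X ≤ A}
    with hf
  have hfinf : ∀ X Y, f X ∩ f Y = f (X ⊔ Y) := by
    intro X Y
    ext A
    exact ⟨fun h => ⟨h.1.1, sup_le h.1.2 h.2.2⟩,
      fun h => ⟨⟨h.1, le_sup_left.trans h.2⟩, ⟨h.1, le_sup_right.trans h.2⟩⟩⟩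
  have hf1 : ∀ X ∈ I, ((f X).ncard : ℚ) = gaussBinom (Nat.card F) (m - 1 + c) (m - 1) :=
    fun X hX => ncard_finrank_and_le hV (by omega) hX.1
  have hf2 : ∀ X ∈ I, ∀ Y ∈ I, X ≠ Y →
      ((f X ∩ f Y).ncard : ℚ) = gaussBinom (Nat.card F) (m - 2 + c) (m - 2) := by
    intro X hX Y hY hXY
    rw [hfinf]
    exact ncard_finrank_and_le hV (by omega) (finrank_sup_eq_of_ne hδ hX.1 hY.1 hX.2.1 hY.2.1 hXY)
  have hf3 : ((f X ∩ f Y ∩ f Z).ncard : ℚ) = gaussBinom (Nat.card F) (m - 3 + c) (m - 3) := by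
    rw [hfinf, hfinf]
    exact ncard_finrank_and_le hV hm hXYZ
  have hne : ∀ W₁ W₂ : Submodule F V, W₁ ∈ I → W₂ ∈ I → X ⊔ Y ⊔ Z ≤ W₁ ⊔ W₂ → False := by
    intro W₁ W₂ h1 h2 hle
    have h3 := Submodule.finrank_sup_add_finrank_inf_eq W₁ W₂
    have h4 : finrank F δ ≤ finrank F (W₁ ⊓ W₂ : Submodule F V) :=
      Submodule.finrank_mono (le_inf h1.2.1 h2.2.1)
    have h5 := Submodule.finrank_mono hle
    have h6 := h1.1
    have h7 := h2.1
    omega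
  have hXY : X ≠ Y := by
    rintro rfl
    exact hne X Z hX hZ (by rw [sup_idem])
  have hYZ : Y ≠ Z := by
    rintro rfl
    exact hne X Y hX hY (by rw [sup_assoc, sup_idem])
  have hsub : {A : Submodule F V | finrank F A = t + m ∧ δ ≤ A ∧ A ⊓ U ≠ δ} ⊆
      f X ∪ ({A | A ∉ f X ∧ ∃ W ∈ (I \ {X}) \ {Y}, A ∈ f W} ∪
        f Y \ (f X ∩ f Y ∪ f Y ∩ f Z)) := by
    rintro A ⟨hA, hδA, hAU⟩
    obtain ⟨W, hW, hWA⟩ := exists_between_of_inf_ne hδ hδU hδA hAU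
    have hAW : A ∈ f W := ⟨hA, hWA⟩
    by_cases hAX : A ∈ f X
    · exact Or.inl hAX
    refine Or.inr ?_
    by_cases hex : ∃ W ∈ (I \ {X}) \ {Y}, A ∈ f W
    · exact Or.inl ⟨hAX, hex⟩
    have hXZ : Z ≠ X := by
      rintro rfl
      exact hne Z Y hX hY (sup_le le_rfl le_sup_left)
    have hAZ : A ∉ f Z := fun h => hex ⟨Z, ⟨⟨hZ, hXZ⟩, hYZ.symm⟩, h⟩
    have hWY : W = Y := by
      by_contra hWY
      exact hex ⟨W, ⟨⟨hW, fun h => hAX (h ▸ hAW)⟩, hWY⟩, hAW⟩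
    subst hWY
    exact Or.inr ⟨hAW, fun h => h.elim (fun h => hAX h.1) fun h => hAZ h.2⟩
  have h1 : (({A | A ∉ f X ∧ ∃ W ∈ (I \ {X}) \ {Y}, A ∈ f W} : Set _).ncard : ℚ) ≤
      ((I \ {X}) \ {Y}).ncard * (gaussBinom (Nat.card F) (m - 1 + c) (m - 1) -
        gaussBinom (Nat.card F) (m - 2 + c) (m - 2)) := by
    refine ncard_le_mul (f := fun W => f W \ (f X ∩ f W)) ?_ ?_
    · rintro A ⟨hAX, W, hW, hAW⟩
      exact ⟨W, hW, hAW, fun h => hAX h.1⟩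
    · rintro W ⟨⟨hW, hWX⟩, -⟩
      rw [cast_ncard_sdiff Set.inter_subset_right, hf1 W hW, hf2 X hX W hW (Ne.symm hWX)]
  have h2 : (((I \ {X}) \ {Y}).ncard : ℚ) = gaussBinom (Nat.card F) (m + 1) 1 - 2 := by
    have hYI : Y ∈ I \ {X} := ⟨hY, hXY.symm⟩
    rw [cast_ncard_sdiff (Set.singleton_subset_iff.2 hYI),
      cast_ncard_sdiff (Set.singleton_subset_iff.2 (show X ∈ I from hX)), hIc, Set.ncard_singleton,
      Set.ncard_singleton]
    push_cast
    ring
  have h3 : ((f Y \ (f X ∩ f Y ∪ f Y ∩ f Z)).ncard : ℚ) =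
      gaussBinom (Nat.card F) (m - 1 + c) (m - 1) - (2 * gaussBinom (Nat.card F) (m - 2 + c) (m - 2)
        - gaussBinom (Nat.card F) (m - 3 + c) (m - 3)) := by
    rw [cast_ncard_sdiff (Set.union_subset Set.inter_subset_right Set.inter_subset_left), hf1 Y hY]
    have h4 := Set.ncard_union_add_ncard_inter (f X ∩ f Y) (f Y ∩ f Z)
    have h5 : f X ∩ f Y ∩ (f Y ∩ f Z) = f X ∩ f Y ∩ f Z := by
      rw [← Set.inter_assoc, Set.inter_assoc (f X), Set.inter_self]
    rw [h5] at h4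
    have h6 : ((f X ∩ f Y ∪ f Y ∩ f Z).ncard : ℚ) + (f X ∩ f Y ∩ f Z).ncard =
      (f X ∩ f Y).ncard + (f Y ∩ f Z).ncard := by exact_mod_cast h4
    rw [hf2 X hX Y hY hXY, hf2 Y hY Z hZ hYZ, hf3] at h6
    linarith
  have h4 := (Set.ncard_le_ncard hsub (Set.toFinite _)).trans
    ((Set.ncard_union_le _ _).trans (Nat.add_le_add_left (Set.ncard_union_le _ _) _))
  have h5 : ({A : Submodule F V | finrank F A = t + m ∧ δ ≤ A ∧ A ⊓ U ≠ δ}.ncard : ℚ) ≤ _ :=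
    Nat.cast_le.2 h4
  push_cast at h5
  rw [hf1 X hX, h3] at h5
  rw [h2] at h1
  linarith

end Subspaces

/-! ### Numerical estimates -/

section Estimates

variable {q : ℕ}

theorem gaussBinom_one_mul (hq : 2 ≤ q) (n : ℕ) :
    gaussBinom q n 1 * ((q : ℚ) - 1) = (q : ℚ) ^ n - 1 := by
  have hq1 : (1 : ℚ) < q := by exact_mod_cast hq
  rw [gaussBinom_one_right, div_mul_cancel₀ _ (sub_pos.2 hq1).ne']

theorem gaussBinom_one_nonneg (hq : 2 ≤ q) (n : ℕ) : 0 ≤ gaussBinom q n 1 := by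
  have hq1 : (1 : ℚ) < q := by exact_mod_cast hq
  rw [gaussBinom_one_right]
  exact div_nonneg (sub_nonneg.2 (one_le_pow₀ hq1.le)) (sub_pos.2 hq1).le

theorem gaussBinom_one_succ (hq : 2 ≤ q) (n : ℕ) :
    gaussBinom q (n + 1) 1 = gaussBinom q n 1 + (q : ℚ) ^ n := by
  have hq1 : (1 : ℚ) < q := by exact_mod_cast hq
  refine mul_right_cancel₀ (sub_pos.2 hq1).ne' ?_
  rw [add_mul, gaussBinom_one_mul hq, gaussBinom_one_mul hq]
  ring

theorem gaussBinom_one_mono (hq : 2 ≤ q) : Monotone fun n => gaussBinom q n 1 :=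
  monotone_nat_of_le_succ fun n => by
    rw [gaussBinom_one_succ hq]
    have : (0 : ℚ) ≤ (q : ℚ) ^ n := by positivity
    linarith

theorem two_mul_gaussBinom_one_le (hq : 3 ≤ q) (n : ℕ) :
    2 * gaussBinom q n 1 ≤ (q : ℚ) ^ n := by
  have hq1 : (3 : ℚ) ≤ q := by exact_mod_cast hq
  have h1 := gaussBinom_one_mul (by omega : 2 ≤ q) n
  nlinarith [gaussBinom_one_nonneg (by omega : 2 ≤ q) n]

theorem gaussBinom_succ_left_mul (n k : ℕ) :
    gaussBinom q (n + 1) k * ((q : ℚ) ^ (n + 1 - k) - 1) =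
      ((q : ℚ) ^ (n + 1) - 1) * gaussBinom q n k := by
  have h := Finset.prod_range_succ (fun i => (q : ℚ) ^ (n + 1 - i) - 1) k
  rw [Finset.prod_range_succ'] at h
  simp only [Nat.add_sub_add_right, Nat.sub_zero] at h
  rw [gaussBinom, gaussBinom, div_mul_eq_mul_div, ← h, mul_comm, mul_div_assoc]

theorem gaussBinom_succ_left_le (hq : 2 ≤ q) {n k : ℕ} (hk : k ≤ n) :
    gaussBinom q (n + 1) k ≤ (q : ℚ) ^ (k + 1) * gaussBinom q n k := by
  have hq1 : (2 : ℚ) ≤ q := by exact_mod_cast hq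
  have h := gaussBinom_succ_left_mul (q := q) n k
  have h1 : (q : ℚ) ≤ (q : ℚ) ^ (n + 1 - k) := le_self_pow₀ (by linarith) (by omega)
  have h2 : (q : ℚ) ^ (n + 1) = (q : ℚ) ^ k * (q : ℚ) ^ (n + 1 - k) := by
    rw [← pow_add]
    congr 1
    omega
  have h3 := gaussBinom_pos hq hk
  have h4 : (0 : ℚ) < (q : ℚ) ^ k := by positivity
  have h5 : (0 : ℚ) < (q : ℚ) ^ (n + 1 - k) - 1 := by linarith
  refine le_of_mul_le_mul_right ?_ h5
  rw [h, h2, pow_succ]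
  have h6 : (q : ℚ) ^ k * (q : ℚ) ^ (n + 1 - k) - 1 ≤
      (q : ℚ) ^ k * q * ((q : ℚ) ^ (n + 1 - k) - 1) := by
    have : (q : ℚ) ^ (n + 1 - k) ≤ q * ((q : ℚ) ^ (n + 1 - k) - 1) := by nlinarith
    nlinarith [mul_le_mul_of_nonneg_left this h4.le]
  nlinarith [mul_le_mul_of_nonneg_right h6 h3.le]

theorem gaussBinom_add_two_mul (hq : 2 ≤ q) (t : ℕ) :
    gaussBinom q (t + 2) t * (((q : ℚ) ^ 2 - 1) * (q - 1)) =
      ((q : ℚ) ^ (t + 2) - 1) * ((q : ℚ) ^ (t + 1) - 1) := by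
  have h := gaussBinom_succ_left_mul (q := q) (t + 1) t
  rw [show t + 1 + 1 - t = 2 by omega] at h
  rw [← mul_assoc, h, gaussBinom_succ_self hq, mul_assoc, gaussBinom_one_mul hq]

variable {t m c : ℕ}

theorem pow_mul_gaussBinom_sub_two_le (hq : 2 ≤ q) (hm : 2 ≤ m) (hc : m + 2 * t + 1 ≤ c) :
    (q : ℚ) ^ m * ((q : ℚ) ^ t) ^ 2 * q * gaussBinom q (m - 2 + c) (m - 2) ≤
      gaussBinom q (m - 1 + c) (m - 1) := by
  have hq1 : (1 : ℚ) ≤ q := by exact_mod_cast (by omega : 1 ≤ q)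
  have h := pow_mul_gaussBinom_le hq c (m - 2)
  rw [show m - 2 + 1 = m - 1 by omega] at h
  refine le_trans (mul_le_mul_of_nonneg_right ?_ (gaussBinom_pos hq (by omega)).le) h
  calc (q : ℚ) ^ m * ((q : ℚ) ^ t) ^ 2 * q = (q : ℚ) ^ (m + 2 * t + 1) := by ring
    _ ≤ (q : ℚ) ^ c := pow_le_pow_right₀ hq1 hc

theorem gaussBinom_one_mul_le (hq : 3 ≤ q) (hm : 2 ≤ m) (hc : m + 2 * t + 1 ≤ c) :
    2 * (gaussBinom q (m + 1) 1 * gaussBinom q (m - 2 + c) (m - 2)) ≤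
      gaussBinom q (m - 1 + c) (m - 1) := by
  have hq1 : (1 : ℚ) ≤ q := by exact_mod_cast (by omega : 1 ≤ q)
  have h1 := pow_mul_gaussBinom_sub_two_le (by omega : 2 ≤ q) hm hc
  have h2 := two_mul_gaussBinom_one_le hq (m + 1)
  have h3 := gaussBinom_pos (by omega : 2 ≤ q) (Nat.le_add_right (m - 2) c)
  refine le_trans ?_ h1
  rw [← mul_assoc]
  refine mul_le_mul_of_nonneg_right (h2.trans ?_) h3.le
  have h4 : (1 : ℚ) ≤ ((q : ℚ) ^ t) ^ 2 := one_le_pow₀ (one_le_pow₀ hq1)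
  have h5 : (0 : ℚ) ≤ (q : ℚ) ^ m * q := by positivity
  rw [pow_succ]
  nlinarith

/-- The factor 4 is absorbed by 2[m+1,1] ≤ q^(m+1), which needs q ≥ 3. The remaining power of q fits
because q^2 ≤ q^t, that is, because the projective t is positive. -/
theorem gaussBinom_one_sq_mul_le (hq : 3 ≤ q) (ht : 2 ≤ t) (hm : 2 ≤ m)
    (hc : m + 2 * t + 1 ≤ c) :
    4 * (q : ℚ) ^ (t + 1) * (gaussBinom q (m + 1) 1 ^ 2 * gaussBinom q (m - 2 + c) (m - 2)) ≤
      (q : ℚ) ^ m * gaussBinom q (m - 1 + c) (m - 1) := by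
  have hq1 : (1 : ℚ) ≤ q := by exact_mod_cast (by omega : 1 ≤ q)
  have h1 := pow_mul_gaussBinom_sub_two_le (by omega : 2 ≤ q) hm hc
  have h2 := two_mul_gaussBinom_one_le hq (m + 1)
  have h3 := gaussBinom_pos (by omega : 2 ≤ q) (Nat.le_add_right (m - 2) c)
  have h4 : (q : ℚ) ^ 2 ≤ (q : ℚ) ^ t := pow_le_pow_right₀ hq1 ht
  have h5 : (2 * gaussBinom q (m + 1) 1) ^ 2 ≤ ((q : ℚ) ^ (m + 1)) ^ 2 :=
    pow_le_pow_left₀ (mul_nonneg two_pos.le (gaussBinom_one_nonneg (by omega) _)) h2 2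
  calc 4 * (q : ℚ) ^ (t + 1) * (gaussBinom q (m + 1) 1 ^ 2 * gaussBinom q (m - 2 + c) (m - 2))
      = (q : ℚ) ^ (t + 1) * ((2 * gaussBinom q (m + 1) 1) ^ 2 *
        gaussBinom q (m - 2 + c) (m - 2)) := by ring
    _ ≤ (q : ℚ) ^ (t + 1) * (((q : ℚ) ^ (m + 1)) ^ 2 * gaussBinom q (m - 2 + c) (m - 2)) := by
      gcongr
    _ = (q : ℚ) ^ m * ((q : ℚ) ^ m * ((q : ℚ) ^ t * (q : ℚ) ^ 2) * q *
        gaussBinom q (m - 2 + c) (m - 2)) := by ring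
    _ ≤ (q : ℚ) ^ m * ((q : ℚ) ^ m * ((q : ℚ) ^ t * (q : ℚ) ^ t) * q *
        gaussBinom q (m - 2 + c) (m - 2)) := by gcongr
    _ ≤ (q : ℚ) ^ m * gaussBinom q (m - 1 + c) (m - 1) := by
      rw [← pow_two]
      gcongr

theorem eight_mul_gaussBinom_one_sq_mul_le (hq : 3 ≤ q) (ht : 2 ≤ t) (hm : 2 ≤ m)
    (hc : m + 2 * t + 1 ≤ c) :
    8 * (gaussBinom q (t + 1) 1 * (gaussBinom q (m + 1) 1 ^ 2 *
      gaussBinom q (m - 2 + c) (m - 2))) ≤ (q : ℚ) ^ m * gaussBinom q (m - 1 + c) (m - 1) := by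
  refine le_trans ?_ (gaussBinom_one_sq_mul_le hq ht hm hc)
  have h2 := two_mul_gaussBinom_one_le hq (t + 1)
  have h3 := gaussBinom_pos (by omega : 2 ≤ q) (Nat.le_add_right (m - 2) c)
  have h4 : 0 ≤ gaussBinom q (m + 1) 1 ^ 2 * gaussBinom q (m - 2 + c) (m - 2) := by positivity
  nlinarith

theorem one_le_gaussBinom_one (hq : 2 ≤ q) (n : ℕ) : 1 ≤ gaussBinom q (n + 1) 1 := by
  have h := gaussBinom_one_mono hq (Nat.le_add_left 1 n)
  have h1 := gaussBinom_one_succ hq 0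
  simp only [zero_add, pow_zero] at h1 h
  linarith [gaussBinom_one_nonneg hq 0]

/-- Since [m+1,1] - [m,1] = q^m, there is a surplus of q^m [m-1+c, m-1] on the right. The branching
term through δ uses at most half of it, and the other terms together at most an eighth. -/
theorem center_estimate (hq : 3 ≤ q) (ht : 2 ≤ t) (hm : 2 ≤ m) (hc : m + 2 * t + 1 ≤ c) :
    gaussBinom q m 1 * gaussBinom q (m - 1 + c) (m - 1) +
        (gaussBinom q (m + 1) 1 - gaussBinom q m 1) *
          (gaussBinom q (m + 1) 1 * gaussBinom q (m - 2 + c) (m - 2)) +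
        (gaussBinom q (t + 1) 1 - 1) * (gaussBinom q (m + 1) 1 * (gaussBinom q (m + 1) 1 *
          gaussBinom q (m - 2 + c) (m - 2))) <
      gaussBinom q (m + 1) 1 * gaussBinom q (m - 1 + c) (m - 1) -
        gaussBinom q (m + 1) 1 ^ 2 * gaussBinom q (m - 2 + c) (m - 2) := by
  have hq0 : (0 : ℚ) < q := by exact_mod_cast (by omega : 0 < q)
  have h1 := eight_mul_gaussBinom_one_sq_mul_le hq ht hm hc
  have h2 := gaussBinom_one_mul_le hq hm hc
  have h3 := gaussBinom_one_succ (by omega : 2 ≤ q) m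
  have h4 : (0 : ℚ) < (q : ℚ) ^ m := by positivity
  have h5 := gaussBinom_pos (by omega : 2 ≤ q) (Nat.le_add_right (m - 1) c)
  have h6 : gaussBinom q (m + 1) 1 - gaussBinom q m 1 = (q : ℚ) ^ m := by linarith
  rw [h6]
  have h7 := mul_le_mul_of_nonneg_left h2 h4.le
  have h8 := mul_pos h4 h5
  have h9 : gaussBinom q (m + 1) 1 * gaussBinom q (m - 1 + c) (m - 1) =
      gaussBinom q m 1 * gaussBinom q (m - 1 + c) (m - 1) +
        (q : ℚ) ^ m * gaussBinom q (m - 1 + c) (m - 1) := by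
    rw [h3]
    ring
  rw [h9]
  linarith

theorem pow_mul_gaussBinom_le_sub (hq : 3 ≤ q) (ht : 2 ≤ t) (hm : 2 ≤ m)
    (hc : m + 2 * t + 1 ≤ c) :
    (q : ℚ) ^ m * gaussBinom q (m - 1 + c) (m - 1) ≤
      gaussBinom q (m + 1) 1 * gaussBinom q (m - 1 + c) (m - 1) -
        gaussBinom q (m + 1) 1 ^ 2 * gaussBinom q (m - 2 + c) (m - 2) := by
  have hq1 : (1 : ℚ) ≤ q := by exact_mod_cast (by omega : 1 ≤ q)
  have h1 := gaussBinom_one_sq_mul_le hq ht hm hc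
  have h3 := gaussBinom_one_succ (by omega : 2 ≤ q) m
  have h4 := gaussBinom_one_succ (by omega : 2 ≤ q) (m - 1)
  rw [show m - 1 + 1 = m by omega] at h4
  have h5 := gaussBinom_pos (by omega : 2 ≤ q) (Nat.le_add_right (m - 1) c)
  have h6 := gaussBinom_pos (by omega : 2 ≤ q) (Nat.le_add_right (m - 2) c)
  have h7 := gaussBinom_one_nonneg (by omega : 2 ≤ q) (m - 1)
  have h8 : (q : ℚ) ^ m = (q : ℚ) ^ (m - 1) * q := by
    rw [← pow_succ]
    congr 1
    omega
  have h9 : (0 : ℚ) ≤ gaussBinom q (m + 1) 1 ^ 2 * gaussBinom q (m - 2 + c) (m - 2) := by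
    positivity
  have h10 : (q : ℚ) ≤ 4 * (q : ℚ) ^ (t + 1) := by
    have : (q : ℚ) ^ 1 ≤ (q : ℚ) ^ (t + 1) := pow_le_pow_right₀ hq1 (by omega)
    rw [pow_one] at this
    linarith
  have h11 := (mul_le_mul_of_nonneg_right h10 h9).trans h1
  rw [h8] at h11
  have h12 : gaussBinom q (m + 1) 1 ^ 2 * gaussBinom q (m - 2 + c) (m - 2) ≤
      (q : ℚ) ^ (m - 1) * gaussBinom q (m - 1 + c) (m - 1) := by
    refine le_of_mul_le_mul_left (h11.trans_eq (by ring)) (by linarith : (0 : ℚ) < q)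
  have h13 : (q : ℚ) ^ (m - 1) ≤ gaussBinom q m 1 := by linarith
  have h14 := mul_le_mul_of_nonneg_right h13 h5.le
  have h15 : gaussBinom q (m + 1) 1 * gaussBinom q (m - 1 + c) (m - 1) =
      gaussBinom q m 1 * gaussBinom q (m - 1 + c) (m - 1) +
        (q : ℚ) ^ m * gaussBinom q (m - 1 + c) (m - 1) := by
    rw [h3]
    ring
  linarith

theorem core_lt_span_estimate (hq : 3 ≤ q) (ht : 2 ≤ t) (hm : t + 2 ≤ m)
    (hc : m + 2 * t + 1 ≤ c) :
    gaussBinom q (t + 2) 1 * (gaussBinom q (m - 1 + c) (m - 1) -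
        gaussBinom q (m - 2 + c) (m - 2)) + gaussBinom q (m - 2 + c) (m - 2) <
      gaussBinom q (m + 1) 1 * gaussBinom q (m - 1 + c) (m - 1) -
        gaussBinom q (m + 1) 1 ^ 2 * gaussBinom q (m - 2 + c) (m - 2) := by
  have hq2 : 2 ≤ q := by omega
  have hq0 : (0 : ℚ) < q := by exact_mod_cast (by omega : 0 < q)
  have h1 := eight_mul_gaussBinom_one_sq_mul_le hq ht (by omega : 2 ≤ m) hc
  have h2 := gaussBinom_pos hq2 (Nat.le_add_right (m - 1) c)
  have h3 := gaussBinom_pos hq2 (Nat.le_add_right (m - 2) c)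
  have h4 : gaussBinom q (t + 2) 1 ≤ gaussBinom q m 1 := gaussBinom_one_mono hq2 hm
  have h5 := one_le_gaussBinom_one hq2 (t + 1)
  have h6 := one_le_gaussBinom_one hq2 t
  have h7 : (0 : ℚ) < (q : ℚ) ^ m * gaussBinom q (m - 1 + c) (m - 1) := by positivity
  have h8 : (0 : ℚ) ≤ gaussBinom q (m + 1) 1 ^ 2 * gaussBinom q (m - 2 + c) (m - 2) := by
    positivity
  rw [show t + 1 + 1 = t + 2 by ring] at h5
  have h9 := mul_le_mul_of_nonneg_right h6 h8
  have h10 := mul_le_mul_of_nonneg_right h4 h2.le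
  have h11 := mul_le_mul_of_nonneg_right h5 h3.le
  have h12 : gaussBinom q (m + 1) 1 * gaussBinom q (m - 1 + c) (m - 1) =
      gaussBinom q m 1 * gaussBinom q (m - 1 + c) (m - 1) +
        (q : ℚ) ^ m * gaussBinom q (m - 1 + c) (m - 1) := by
    rw [gaussBinom_one_succ hq2]
    ring
  linarith

theorem pow_le_gaussBinom_sub (hq : 2 ≤ q) {i : ℕ} (hi : i < m) (hc : m + 2 * t + 1 ≤ c) :
    (q : ℚ) ^ m * ((q : ℚ) ^ t) ^ 2 * q ≤ gaussBinom q (m - i + c) (m - i) := by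
  have hq1 : (1 : ℚ) ≤ q := by exact_mod_cast (by omega : 1 ≤ q)
  calc (q : ℚ) ^ m * ((q : ℚ) ^ t) ^ 2 * q = (q : ℚ) ^ (m + 2 * t + 1) := by ring
    _ ≤ (q : ℚ) ^ (c * (m - i)) := by
      refine pow_le_pow_right₀ hq1 (hc.trans ?_)
      exact Nat.le_mul_of_pos_right c (by omega)
    _ ≤ _ := pow_le_gaussBinom hq c (m - i)

/-- Here [t+2,1] exceeds [m+1,1] by at least q^(t+1) ≥ 3. Three copies of [m-1+c, m-1] pay for
[t+m+1,1] and for the subtracted term, each at most half a copy. -/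
theorem span_lt_core_estimate (hq : 3 ≤ q) (hm : 2 ≤ m) (hmt : m ≤ t)
    (hc : m + 2 * t + 1 ≤ c) :
    gaussBinom q (t + m + 1) 1 - gaussBinom q (m + 1) 1 +
        gaussBinom q (m + 1) 1 * gaussBinom q (m - 1 + c) (m - 1) <
      gaussBinom q (t + 2) 1 * (gaussBinom q (m - 1 + c) (m - 1) -
        gaussBinom q (m - 2 + c) (m - 2)) + gaussBinom q (m - 2 + c) (m - 2) := by
  have hq2 : 2 ≤ q := by omega
  have hq3 : (3 : ℚ) ≤ q := by exact_mod_cast hq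
  have h1 : gaussBinom q (m + 1) 1 ≤ gaussBinom q (t + 1) 1 :=
    gaussBinom_one_mono hq2 (Nat.succ_le_succ hmt)
  have h2 := gaussBinom_pos hq2 (Nat.le_add_right (m - 1) c)
  have h3 := gaussBinom_pos hq2 (Nat.le_add_right (m - 2) c)
  have h4 := gaussBinom_one_succ hq2 (t + 1)
  have h5 := two_mul_gaussBinom_one_le hq (t + 2)
  have h6 := two_mul_gaussBinom_one_le hq (t + m + 1)
  have h7 := pow_mul_gaussBinom_sub_two_le hq2 hm hc
  have h8 := pow_le_gaussBinom_sub (t := t) hq2 (by omega : 1 < m) hc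
  have hy : (1 : ℚ) ≤ (q : ℚ) ^ t := one_le_pow₀ (by linarith)
  have hx : (q : ℚ) ≤ (q : ℚ) ^ m := le_self_pow₀ (by linarith) (by omega)
  have h9 : 2 * gaussBinom q (t + m + 1) 1 ≤ gaussBinom q (m - 1 + c) (m - 1) := by
    refine h6.trans (le_trans ?_ h8)
    rw [show (q : ℚ) ^ (t + m + 1) = (q : ℚ) ^ m * (q : ℚ) ^ t * q by ring]
    gcongr
    exact le_self_pow₀ hy two_ne_zero
  have h10 : 2 * (gaussBinom q (t + 2) 1 * gaussBinom q (m - 2 + c) (m - 2)) ≤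
      gaussBinom q (m - 1 + c) (m - 1) := by
    refine le_trans ?_ h7
    rw [← mul_assoc]
    refine mul_le_mul_of_nonneg_right (h5.trans ?_) h3.le
    rw [show (q : ℚ) ^ (t + 2) = q * (q : ℚ) ^ t * q by ring]
    gcongr
    exact le_self_pow₀ hy two_ne_zero
  have h11 : (3 : ℚ) ≤ (q : ℚ) ^ (t + 1) :=
    hq3.trans (le_self_pow₀ (by linarith) (Nat.succ_ne_zero t))
  have h12 := one_le_gaussBinom_one hq2 m
  have h13 : (gaussBinom q (m + 1) 1 + 3) * gaussBinom q (m - 1 + c) (m - 1) ≤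
      gaussBinom q (t + 2) 1 * gaussBinom q (m - 1 + c) (m - 1) :=
    mul_le_mul_of_nonneg_right (by rw [h4]; linarith) h2.le
  linarith

/-- The terms in [m-1+c, m-1] cancel. What decides is that [t+m+1,1] is at most half of [m-2+c,
m-2], while [m-3+c, m-3] is at most a third of it. -/
theorem span_lt_core_estimate_of_eq (hq : 3 ≤ q) (ht : 2 ≤ t) (hmt : m = t + 1)
    (hc : m + 2 * t + 1 ≤ c) :
    gaussBinom q (t + m + 1) 1 - gaussBinom q (m + 1) 1 +
        (gaussBinom q (m - 1 + c) (m - 1) + (gaussBinom q (m + 1) 1 - 1) *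
          (gaussBinom q (m - 1 + c) (m - 1) - gaussBinom q (m - 2 + c) (m - 2)) -
          (gaussBinom q (m - 2 + c) (m - 2) - gaussBinom q (m - 3 + c) (m - 3))) <
      gaussBinom q (t + 2) 1 * (gaussBinom q (m - 1 + c) (m - 1) -
        gaussBinom q (m - 2 + c) (m - 2)) + gaussBinom q (m - 2 + c) (m - 2) := by
  have hq2 : 2 ≤ q := by omega
  have hq3 : (3 : ℚ) ≤ q := by exact_mod_cast hq
  have h1 := one_le_gaussBinom_one hq2 m
  have h2 := gaussBinom_pos hq2 (Nat.le_add_right (m - 3) c)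
  have h3 := pow_mul_gaussBinom_le hq2 c (m - 3)
  rw [show m - 3 + 1 = m - 2 by omega] at h3
  have h4 := pow_le_gaussBinom_sub (t := t) hq2 (by omega : 2 < m) hc
  have h5 := two_mul_gaussBinom_one_le hq (t + m + 1)
  have h6 : (3 : ℚ) ≤ (q : ℚ) ^ c := hq3.trans (le_self_pow₀ (by linarith) (by omega))
  have hy : (1 : ℚ) ≤ (q : ℚ) ^ t := one_le_pow₀ (by linarith)
  have h7 : 2 * gaussBinom q (t + m + 1) 1 ≤ gaussBinom q (m - 2 + c) (m - 2) := by
    refine h5.trans (le_trans ?_ h4)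
    rw [show (q : ℚ) ^ (t + m + 1) = (q : ℚ) ^ m * (q : ℚ) ^ t * q by ring]
    gcongr
    exact le_self_pow₀ hy two_ne_zero
  have h8 := mul_le_mul_of_nonneg_right h6 h2.le
  rw [show t + 2 = m + 1 by omega]
  nlinarith

/-- Raising s by one costs at most q^(t+1) for the choice of a t-subspace and q^(m+1) for a
branching, and gains q^c; so only s = 2 needs a sharp estimate. -/
theorem gaussBinom_cover_step (hq : 2 ≤ q) (ht : 1 ≤ t) (hc : m + 2 * t + 1 ≤ c) (s i : ℕ) :
    gaussBinom q (t + (s + 1)) t *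
        (gaussBinom q (m + 1) 1 ^ (s + 1) * gaussBinom q (i + c) i) ≤
      gaussBinom q (t + s) t *
        (gaussBinom q (m + 1) 1 ^ s * gaussBinom q (i + 1 + c) (i + 1)) := by
  have hq1 : (2 : ℚ) ≤ q := by exact_mod_cast hq
  have h1 := gaussBinom_succ_left_le hq (Nat.le_add_right t s)
  have h2 := pow_mul_gaussBinom_le hq c i
  have h3 := gaussBinom_pos hq (Nat.le_add_right i c)
  have h4 := gaussBinom_pos hq (Nat.le_add_right t s)
  have h5 : gaussBinom q (m + 1) 1 ≤ (q : ℚ) ^ (m + 1) := by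
    have := gaussBinom_one_mul hq (m + 1)
    nlinarith [gaussBinom_one_nonneg hq (m + 1)]
  have h6 := gaussBinom_one_nonneg hq (m + 1)
  calc gaussBinom q (t + (s + 1)) t *
        (gaussBinom q (m + 1) 1 ^ (s + 1) * gaussBinom q (i + c) i)
      ≤ (q : ℚ) ^ (t + 1) * gaussBinom q (t + s) t *
        (gaussBinom q (m + 1) 1 ^ s * (q : ℚ) ^ (m + 1) * gaussBinom q (i + c) i) := by
        rw [← add_assoc, pow_succ]
        gcongr
    _ = gaussBinom q (t + s) t * (gaussBinom q (m + 1) 1 ^ s *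
        ((q : ℚ) ^ (t + 1 + (m + 1)) * gaussBinom q (i + c) i)) := by ring
    _ ≤ gaussBinom q (t + s) t * (gaussBinom q (m + 1) 1 ^ s *
        ((q : ℚ) ^ c * gaussBinom q (i + c) i)) := by
        gcongr
        · linarith
        · omega
    _ ≤ _ := by gcongr

theorem gaussBinom_cover_le (hq : 2 ≤ q) (ht : 1 ≤ t) (hc : m + 2 * t + 1 ≤ c) (j : ℕ) :
    ∀ i, gaussBinom q (t + (2 + j)) t *
        (gaussBinom q (m + 1) 1 ^ (2 + j) * gaussBinom q (i + c) i) ≤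
      gaussBinom q (t + 2) t *
        (gaussBinom q (m + 1) 1 ^ 2 * gaussBinom q (i + j + c) (i + j)) := by
  induction j with
  | zero => exact fun i => le_rfl
  | succ j ih =>
    intro i
    have h := ih (i + 1)
    rw [show i + 1 + j = i + (j + 1) by ring] at h
    exact (gaussBinom_cover_step hq ht hc (2 + j) i).trans h

theorem gaussBinom_cover_two_lt (ht : 2 ≤ t) (hm : 2 ≤ m)
    (hqc : (4 ≤ q ∧ m + 2 * t + 1 ≤ c) ∨ (q = 3 ∧ m + 2 * t + 2 ≤ c)) :
    gaussBinom q (t + 2) t *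
        (gaussBinom q (m + 1) 1 ^ 2 * gaussBinom q (m - 2 + c) (m - 2)) <
      (q : ℚ) ^ m * gaussBinom q (m - 1 + c) (m - 1) := by
  have hq2 : 2 ≤ q := by omega
  have hq0 : (2 : ℚ) ≤ q := by exact_mod_cast hq2
  set Q : ℚ := (q : ℚ) with hQ
  set L := gaussBinom q (m - 1 + c) (m - 1) with hL
  set M := gaussBinom q (m - 2 + c) (m - 2) with hM
  have hM0 : 0 < M := gaussBinom_pos hq2 (Nat.le_add_right (m - 2) c)
  have hL0 : 0 < L := gaussBinom_pos hq2 (Nat.le_add_right (m - 1) c)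
  have hpos : 0 < (Q ^ 2 - 1) * (Q - 1) ^ 3 :=
    mul_pos (by nlinarith) (pow_pos (by linarith) 3)
  -- The split of the hypothesis on n comes from here. The polynomial (q^2-1)(q-1)^3 clears the
  -- denominators of [t+2,t] and [m+1,1]^2. It is at least q^4 for q ≥ 4, but for q = 3 it is 64 <
  -- 81; one more unit in c then leaves 27 ≤ 64.
  have key : Q ^ 4 * (Q ^ m * (Q ^ t) ^ 2 * Q * M) ≤ (Q ^ 2 - 1) * (Q - 1) ^ 3 * L := by
    rcases hqc with ⟨h4, hc⟩ | ⟨h3, hc⟩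
    · have hq4 : (4 : ℚ) ≤ Q := by rw [hQ]; exact_mod_cast h4
      have h1 := pow_mul_gaussBinom_sub_two_le hq2 hm hc
      refine mul_le_mul ?_ h1 (by positivity) hpos.le
      obtain ⟨u, hu⟩ : ∃ u, Q = u + 4 := ⟨Q - 4, by ring⟩
      have hu0 : 0 ≤ u := by linarith
      rw [hu]
      have : 0 ≤ ((u + 4) ^ 2 - 1) * (u + 4 - 1) ^ 3 - (u + 4) ^ 4 := by
        ring_nf
        positivity
      linarith
    · have h1 := pow_mul_gaussBinom_le hq2 c (m - 2)
      rw [show m - 2 + 1 = m - 1 by omega] at h1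
      have hQ3 : Q = 3 := by rw [hQ, h3]; norm_num
      have h2 : Q ^ (m + 2 * t + 2) ≤ Q ^ c := pow_le_pow_right₀ (by linarith) hc
      have h4 := (mul_le_mul_of_nonneg_right h2 hM0.le).trans h1
      have h5 : Q ^ 4 * (Q ^ m * (Q ^ t) ^ 2 * Q * M) = Q ^ 3 * (Q ^ (m + 2 * t + 2) * M) := by
        ring
      rw [h5]
      refine (mul_le_mul_of_nonneg_left h4 (by positivity)).trans ?_
      rw [hQ3]
      nlinarith
  have h1 := gaussBinom_add_two_mul hq2 t
  have h2 := gaussBinom_one_mul hq2 (m + 1)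
  rw [← hQ] at h1 h2
  refine lt_of_mul_lt_mul_left ?_ hpos.le
  have hx : 1 < Q ^ (m + 1) := one_lt_pow₀ (by linarith) (Nat.succ_ne_zero m)
  have hy : 1 < Q ^ (t + 1) := one_lt_pow₀ (by linarith) (Nat.succ_ne_zero t)
  have hz : 1 < Q ^ (t + 2) := one_lt_pow₀ (by linarith) (by omega)
  calc (Q ^ 2 - 1) * (Q - 1) ^ 3 * (gaussBinom q (t + 2) t * (gaussBinom q (m + 1) 1 ^ 2 * M))
      = (gaussBinom q (t + 2) t * ((Q ^ 2 - 1) * (Q - 1))) *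
        ((gaussBinom q (m + 1) 1 * (Q - 1)) ^ 2 * M) := by ring
    _ = (Q ^ (t + 2) - 1) * (Q ^ (t + 1) - 1) * ((Q ^ (m + 1) - 1) ^ 2 * M) := by rw [h1, h2]
    _ < Q ^ (t + 2) * Q ^ (t + 1) * ((Q ^ (m + 1)) ^ 2 * M) := by
      have ha : (Q ^ (t + 2) - 1) * (Q ^ (t + 1) - 1) < Q ^ (t + 2) * Q ^ (t + 1) := by
        nlinarith
      have hb : (Q ^ (m + 1) - 1) ^ 2 ≤ (Q ^ (m + 1)) ^ 2 :=
        pow_le_pow_left₀ (by linarith) (by linarith) 2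
      refine mul_lt_mul ha (mul_le_mul_of_nonneg_right hb hM0.le) ?_ (by positivity)
      exact mul_pos (pow_pos (by linarith) 2) hM0
    _ = Q ^ m * (Q ^ 4 * (Q ^ m * (Q ^ t) ^ 2 * Q * M)) := by ring
    _ ≤ Q ^ m * ((Q ^ 2 - 1) * (Q - 1) ^ 3 * L) := by gcongr
    _ = _ := by ring

theorem gaussBinom_cover_lt (ht : 2 ≤ t)
    (hqc : (4 ≤ q ∧ m + 2 * t + 1 ≤ c) ∨ (q = 3 ∧ m + 2 * t + 2 ≤ c)) {s : ℕ} (hs : 2 ≤ s)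
    (hsm : s ≤ m) :
    gaussBinom q (t + s) t *
        (gaussBinom q (m + 1) 1 ^ s * gaussBinom q (m - s + c) (m - s)) <
      (q : ℚ) ^ m * gaussBinom q (m - 1 + c) (m - 1) := by
  obtain ⟨j, rfl⟩ := Nat.exists_eq_add_of_le hs
  have h := gaussBinom_cover_le (q := q) (t := t) (m := m) (c := c) (by omega) (by omega)
    (by omega) j (m - (2 + j))
  rw [show m - (2 + j) + j = m - 2 by omega] at h
  exact h.trans_lt (gaussBinom_cover_two_lt ht (by omega) hqc)

end Estimates

/-! ### Classification of large families -/

section Subspaces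

variable {F V : Type*} [Field F] [AddCommGroup V] [Module F V] [Module.Finite F V] [Finite F]

theorem IsMaxFamily.nonempty {t m c : ℕ} {S : Set (Submodule F V)} (hS : IsMaxFamily t m S)
    (hV : finrank F V = t + m + c) : S.Nonempty := by
  obtain ⟨C, -, hC⟩ := exists_le_finrank_eq (⊤ : Submodule F V) (j := t + m)
    (by rw [finrank_top]; omega)
  by_contra h
  rw [Set.not_nonempty_iff_eq_empty] at h
  have := hS.mem C hC fun A hA => by simp [h] at hA
  simp [h] at this

theorem IsMaxFamily.eq_core_or_eq_span_or_ncard_lt {t m c : ℕ} {S : Set (Submodule F V)}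
    (hS : IsMaxFamily t m S) (hV : finrank F V = t + m + c) (ht : 2 ≤ t) (hm : 2 ≤ m)
    (hqc : (4 ≤ Nat.card F ∧ m + 2 * t + 1 ≤ c) ∨ (Nat.card F = 3 ∧ m + 2 * t + 2 ≤ c))
    (hnt : ∀ δ : Submodule F V, finrank F δ = t → ∃ A ∈ S, ¬δ ≤ A) :
    (∃ Γ : Submodule F V, finrank F Γ = t + 2 ∧
      S = {A : Submodule F V | finrank F A = t + m ∧
        t + 1 ≤ finrank F (A ⊓ Γ : Submodule F V)}) ∨
    (∃ δ B : Submodule F V, finrank F δ = t ∧ finrank F B = t + m ∧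
      finrank F (B ⊓ δ : Submodule F V) + 1 = t ∧
      S = {A : Submodule F V | finrank F A = t + m ∧ A ≤ B ⊔ δ} ∪
        {A : Submodule F V | finrank F A = t + m ∧ δ ≤ A ∧
          t + 1 ≤ finrank F (A ⊓ (B ⊔ δ) : Submodule F V)}) ∨
    (S.ncard : ℚ) < gaussBinom (Nat.card F) (m + 1) 1 * gaussBinom (Nat.card F) (m - 1 + c) (m - 1)
      - gaussBinom (Nat.card F) (m + 1) 1 ^ 2 * gaussBinom (Nat.card F) (m - 2 + c) (m - 2) := by
  have : Finite V := Module.finite_of_finite F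
  have hq : 3 ≤ Nat.card F := by omega
  have hc : m + 2 * t + 1 ≤ c := by omega
  obtain ⟨A₀, hA₀⟩ := hS.nonempty hV
  -- Every member is a cover, so a cover X of least dimension exists, of dimension at most t+m.
  have hex : ∃ d, ∃ X : Submodule F V, finrank F X = d ∧ IsCover t S X :=
    ⟨_, A₀, rfl, fun A hA => hS.le_finrank_inf A hA A₀ hA₀⟩
  classical
  obtain ⟨X, hXd, hXc⟩ := Nat.find_spec hex
  have hmin : ∀ Y : Submodule F V, finrank F Y < finrank F X → ¬IsCover t S Y :=
    fun Y hY hYc => Nat.find_min hex (hXd ▸ hY) ⟨Y, rfl, hYc⟩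
  have hXle : finrank F X ≤ t + m := by
    rw [← hS.finrank_eq A₀ hA₀]
    by_contra hlt
    exact hmin A₀ (not_le.1 hlt) fun A hA => hS.le_finrank_inf A hA A₀ hA₀
  have h0 : ∀ Y : Submodule F V, finrank F Y = t → ¬IsCover t S Y := by
    intro Y hY hYc
    obtain ⟨A, hA, hYA⟩ := hnt Y hY
    have h1 := finrank_inf_lt_of_not_le hYA
    have h2 := hYc A hA
    omega
  have hXt : t + 1 ≤ finrank F X := by
    have h1 : t ≤ finrank F X := (hXc A₀ hA₀).trans (Submodule.finrank_mono inf_le_right)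
    have h2 : finrank F X ≠ t := fun h => h0 X h hXc
    omega
  obtain ⟨s, hs⟩ := Nat.exists_eq_add_of_le (le_of_lt hXt)
  rcases Nat.lt_or_ge s 2 with hs2 | hs2
  swap
  · refine Or.inr (Or.inr ?_)
    refine (hS.ncard_le_of_isCover hV hs (by omega) hXc (by rwa [← hs])).trans_lt ?_
    exact (gaussBinom_cover_lt ht hqc hs2 (by omega)).trans_le
      (pow_mul_gaussBinom_le_sub hq ht hm hc)
  have hX : finrank F X = t + 1 := by omega
  set 𝒯 : Set (Submodule F V) := {Y | finrank F Y = t + 1 ∧ IsCover t S Y} with h𝒯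
  rcases exists_center_or_exists_span (S := S) (𝒯 := 𝒯) ⟨X, hX, hXc⟩ (fun Y hY => hY.2)
    (fun Y hY => hY.1) (fun Y hY Z hZ => hS.le_finrank_inf_of_isCover hV (by omega) (by omega)
      hY.2 hZ.2 hY.1 hZ.1) with ⟨δ, hδ, hδ𝒯⟩ | ⟨Γ, hΓ, hΓS⟩
  swap
  · exact Or.inl ⟨Γ, hΓ, hS.eq_core hΓ hΓS⟩
  refine Or.inr ?_
  have hδX : δ ≤ X := hδ𝒯 X ⟨hX, hXc⟩
  obtain ⟨B, hB, hδB⟩ := hnt δ hδ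
  have hBδ : ∀ A ∈ S, ¬δ ≤ A → finrank F (A ⊓ δ : Submodule F V) + 1 = t :=
    fun A hA hδA => finrank_inf_eq_of_not_le hδ hX hδX hδA (hXc A hA)
  have hdim : ∀ A ∈ S, ¬δ ≤ A → finrank F (A ⊔ δ : Submodule F V) = t + m + 1 := by
    intro A hA hδA
    have h1 := Submodule.finrank_sup_add_finrank_inf_eq A δ
    have h2 := hBδ A hA hδA
    have h3 := hS.finrank_eq A hA
    omega
  set U : Submodule F V := sSup 𝒯 with hU
  have hUle : ∀ A ∈ S, ¬δ ≤ A → U ≤ A ⊔ δ := by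
    intro A hA hδA
    refine sSup_le fun Y hY => ?_
    rw [← inf_sup_eq_of_not_le hδ hY.1 (hδ𝒯 Y hY) hδA (hY.2 A hA)]
    exact sup_le_sup_right inf_le_left δ
  have hXU : X ≤ U := le_sSup ⟨hX, hXc⟩
  -- U lies in every A ⊔ δ with A a member not through δ. If dim U > t+m, it equals all these
  -- (t+m+1)-spaces, so they coincide.
  rcases Nat.lt_or_ge (t + m) (finrank F U) with hUd | hUd
  · refine Or.inl ⟨δ, B, hδ, hS.finrank_eq B hB, hBδ B hB hδB, ?_⟩
    refine hS.eq_span (by omega) hδ hB (hBδ B hB hδB) fun A hA hδA => ?_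
    have h1 : U = A ⊔ δ := Submodule.eq_of_le_of_finrank_le (hUle A hA hδA)
      (by rw [hdim A hA hδA]; omega)
    refine (le_sup_left : A ≤ A ⊔ δ).trans ?_
    rw [← h1]
    exact hUle B hB hδB
  · refine Or.inr ?_
    have h1 := hS.ncard_through_center_le hV hm hδ hB hδB (hδX.trans hXU) hUd
      (fun Y hY hYc => le_sSup ⟨hY, hYc⟩) (by
        have h2 := gaussBinom_one_mul_le hq hm hc
        have h3 : 0 ≤ gaussBinom (Nat.card F) (m + 1) 1 *
            gaussBinom (Nat.card F) (m - 2 + c) (m - 2) :=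
          mul_nonneg (gaussBinom_one_nonneg (by omega) _)
            (gaussBinom_pos (by omega) (by omega)).le
        linarith)
    have h2 := hS.ncard_not_through_center_le hV hm hδ hδX hX hXc h0
      fun Y hY hYc => hδ𝒯 Y ⟨hY, hYc⟩
    have h3 := center_estimate hq ht hm hc
    have h4 : (S.ncard : ℚ) ≤ ({A | A ∈ S ∧ δ ≤ A} : Set _).ncard +
        ({A | A ∈ S ∧ ¬δ ≤ A} : Set _).ncard := by
      have hsub : S ⊆ {A | A ∈ S ∧ δ ≤ A} ∪ {A | A ∈ S ∧ ¬δ ≤ A} := by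
        intro A hA
        by_cases h : δ ≤ A
        exacts [Or.inl ⟨hA, h⟩, Or.inr ⟨hA, h⟩]
      exact_mod_cast (Set.ncard_le_ncard hsub (Set.toFinite _)).trans (Set.ncard_union_le _ _)
    linarith

/-- The spaces δ and U only serve as a model: the closed formula f₁ counts subspaces relative to
them, so bounds on that count become bounds on f₁. -/
theorem span_bounds {t m c : ℕ} (hV : finrank F V = t + m + c) (ht : 2 ≤ t) (hm : 2 ≤ m)
    (hq : 3 ≤ Nat.card F) (hc : m + 2 * t + 1 ≤ c) {δ U : Submodule F V}
    (hδ : finrank F δ = t) (hU : finrank F U = t + m + 1) (hδU : δ ≤ U) :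
    let f₁ := gaussBinom (Nat.card F) (t + m + 1) 1 - gaussBinom (Nat.card F) (m + 1) 1 +
      (gaussBinom (Nat.card F) (m + c) m -
        (Nat.card F : ℚ) ^ ((m + 1) * m) * gaussBinom (Nat.card F) (c - 1) m)
    let f₂ := gaussBinom (Nat.card F) (t + 2) 1 * (gaussBinom (Nat.card F) (m - 1 + c) (m - 1) -
        gaussBinom (Nat.card F) (m - 2 + c) (m - 2)) +
        gaussBinom (Nat.card F) (m - 2 + c) (m - 2)
    gaussBinom (Nat.card F) (m + 1) 1 * gaussBinom (Nat.card F) (m - 1 + c) (m - 1)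
      - gaussBinom (Nat.card F) (m + 1) 1 ^ 2 * gaussBinom (Nat.card F) (m - 2 + c) (m - 2) ≤ f₁ ∧
    (t + 2 ≤ m → f₂ < f₁) ∧ (m ≤ t + 1 → f₁ < f₂) := by
  intro f₁ f₂
  have h1 := le_ncard_inf_ne hV hm hδ hU hδU
  have h2 := ncard_inf_ne_le hV hm hδ hU hδU
  have h3 := ncard_inf_ne hV hm (by omega) hδ hU hδU
  have h4 : gaussBinom (Nat.card F) (m + 1) 1 ≤ gaussBinom (Nat.card F) (t + m + 1) 1 :=
    gaussBinom_one_mono (by omega) (by omega)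
  rw [h3] at h1 h2
  refine ⟨by linarith, fun hmt => ?_, fun hmt => ?_⟩
  · have := core_lt_span_estimate hq ht hmt hc
    linarith
  · rcases Nat.lt_or_ge t m with hlt | hge
    · have h5 := ncard_inf_ne_le_sub hV (by omega) hδ hU hδU
      rw [h3] at h5
      have := span_lt_core_estimate_of_eq hq ht (by omega) hc
      linarith
    · have := span_lt_core_estimate hq hm hge hc
      linarith

end Subspaces

/-! ### From projective to linear dimensions, and the theorem -/

theorem fp_eq {q t m c : ℕ} (hm : 2 ≤ m) :
    fp q (t + m + c) (t + m) t = max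
      (gaussBinom q (t + 1 + m + 1) 1 - gaussBinom q (m + 1) 1 +
        (gaussBinom q (m + c) m - (q : ℚ) ^ ((m + 1) * m) * gaussBinom q (c - 1) m))
      (gaussBinom q (t + 1 + 2) 1 * (gaussBinom q (m - 1 + c) (m - 1) -
        gaussBinom q (m - 2 + c) (m - 2)) + gaussBinom q (m - 2 + c) (m - 2)) := by
  rw [fp, theta, theta, theta, show t + m - t = m by omega, show t + m + c - t = m + c by omega,
    show t + m + c - (t + m) - 1 = c - 1 by omega, show m + c - 1 = m - 1 + c by omega,
    show m + c - 2 = m - 2 + c by omega, show t + m + 1 + 1 = t + 1 + m + 1 by ring,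
    show t + 2 + 1 = t + 1 + 2 by ring, add_sub_assoc]

theorem isMaxFamily_of_maximal {F V : Type*} [Field F] [AddCommGroup V] [Module F V] {k t m : ℕ}
    (hk : k = t + m) {S : Set (Submodule F V)} (hS : Maximal (IsIntersectingFamily k t) S) :
    IsMaxFamily (t + 1) m S where
  finrank_eq A hA := by
    have := hS.prop.1 A hA
    rw [IsSpace] at this
    omega
  le_finrank_inf A hA B hB := by
    by_cases h : A = B
    · have := hS.prop.1 A hA
      rw [IsSpace] at this
      rw [← h, inf_idem]
      omega
    · exact hS.prop.2 A hA B hB h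
  mem C hC h := by
    have hC' : IsSpace k C := by
      rw [IsSpace]
      omega
    -- Adjoining C keeps the family intersecting, so inclusion-maximality puts C in `S`.
    refine hS.le_of_ge (y := insert C S) ⟨?_, ?_⟩ (Set.subset_insert C S) (Set.mem_insert C S)
    · rintro A (rfl | hA)
      exacts [hC', hS.prop.1 A hA]
    · rintro A (rfl | hA) B (rfl | hB) hAB
      · exact absurd rfl hAB
      · rw [MeetAtLeast, inf_comm]
        exact h B hB
      · exact h A hA
      · exact hS.prop.2 A hA B hB hAB

end ProjHM

theorem mainTheorem1 {F V : Type*} [Field F] [AddCommGroup V] [Module F V]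
    (q n k t : ℕ) (hq : Nat.card F = q) (hn : Module.finrank F V = n + 1)
    (ht : 0 < t) (hk : t + 1 < k)
    (hqn : (4 ≤ q ∧ 2 * k + t + 2 < n) ∨ (q = 3 ∧ 2 * k + t + 3 < n))
    (S : Set (Submodule F V)) (hS : Maximal (ProjHM.IsIntersectingFamily k t) S)
    (hpencil : ¬ ProjHM.IsPencil k t S) :
    (S.ncard : ℚ) ≤ ProjHM.fp q n k t ∧
      ((S.ncard : ℚ) = ProjHM.fp q n k t ↔
        (2 * t + 2 < k ∧ ProjHM.IsSpanExample k t S) ∨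
        (k ≤ 2 * t + 2 ∧ ProjHM.IsCoreExample k t S)) := by
  obtain ⟨m, rfl⟩ := Nat.exists_eq_add_of_le (by omega : t ≤ k)
  obtain ⟨c, rfl⟩ := Nat.exists_eq_add_of_le (by omega : t + m ≤ n)
  subst hq
  -- An infinite field would have `Nat.card F = 0`, and an infinite-dimensional space `finrank` 0;
  -- the hypotheses exclude both.
  have : Finite F := Nat.finite_of_card_ne_zero (by omega)
  have : Module.Finite F V := Module.finite_of_finrank_pos (by omega)
  have hm : 2 ≤ m := by omega
  have hqc : (4 ≤ Nat.card F ∧ m + 2 * (t + 1) + 1 ≤ c) ∨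
      (Nat.card F = 3 ∧ m + 2 * (t + 1) + 2 ≤ c) := by omega
  have hc : m + 2 * (t + 1) + 1 ≤ c := by omega
  have hV : Module.finrank F V = t + 1 + m + c := by omega
  have hM := ProjHM.isMaxFamily_of_maximal rfl hS
  have hnt : ∀ δ : Submodule F V, Module.finrank F δ = t + 1 → ∃ A ∈ S, ¬δ ≤ A := by
    intro δ hδ
    by_contra hcon
    push Not at hcon
    refine hpencil ⟨δ, hδ, ?_⟩
    refine hM.eq_of_subset (fun A hA => ⟨hS.prop.1 A hA, hcon A hA⟩) ?_ ?_
    · rintro A ⟨hA, -⟩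
      rw [ProjHM.IsSpace] at hA
      omega
    · rintro A ⟨-, hA⟩ B ⟨-, hB⟩
      rw [← hδ]
      exact Submodule.finrank_mono (le_inf hA hB)
  -- An arbitrary pair δ ≤ U of the right dimensions, unrelated to `S`, on which to evaluate
  -- `span_bounds`.
  obtain ⟨U, -, hU⟩ := ProjHM.exists_le_finrank_eq (⊤ : Submodule F V) (j := t + 1 + m + 1)
    (by rw [finrank_top]; omega)
  obtain ⟨δ, hδU, hδ⟩ := ProjHM.exists_le_finrank_eq U (j := t + 1) (by omega)
  obtain ⟨hlow, hspan, hcore⟩ :=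
    ProjHM.span_bounds hV (by omega) hm (by omega) hc hδ hU hδU
  rw [ProjHM.fp_eq hm]
  have hspace : ∀ A : Submodule F V,
      ProjHM.IsSpace (t + m) A ↔ Module.finrank F A = t + 1 + m := by
    intro A
    rw [ProjHM.IsSpace]
    omega
  have hspanEq : ∀ δ π : Submodule F V, Module.finrank F δ = t + 1 →
      Module.finrank F π = t + 1 + m → Module.finrank F (π ⊓ δ : Submodule F V) = t →
      S = {A | ProjHM.IsSpace (t + m) A ∧ A ≤ π ⊔ δ} ∪
        {A | ProjHM.IsSpace (t + m) A ∧ δ ≤ A ∧ ProjHM.MeetAtLeast (t + 1) A (π ⊔ δ)} →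
      (S.ncard : ℚ) = ProjHM.gaussBinom (Nat.card F) (t + 1 + m + 1) 1 -
        ProjHM.gaussBinom (Nat.card F) (m + 1) 1 + (ProjHM.gaussBinom (Nat.card F) (m + c) m -
        (Nat.card F : ℚ) ^ ((m + 1) * m) * ProjHM.gaussBinom (Nat.card F) (c - 1) m) := by
    intro δ π hδ hπ hπδ hSeq
    have hd := Submodule.finrank_sup_add_finrank_inf_eq π δ
    have hU : Module.finrank F (π ⊔ δ : Submodule F V) = t + 1 + m + 1 := by omega
    rw [← ProjHM.ncard_inf_ne hV hm (by omega) hδ hU le_sup_right,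
      ← ProjHM.ncard_span hm hδ hU le_sup_right, hSeq]
    simp only [hspace, ProjHM.MeetAtLeast]
  have hcoreEq : ∀ Γ : Submodule F V, Module.finrank F Γ = t + 1 + 2 →
      S = {A | ProjHM.IsSpace (t + m) A ∧ ProjHM.MeetAtLeast (t + 1) A Γ} →
      (S.ncard : ℚ) = ProjHM.gaussBinom (Nat.card F) (t + 1 + 2) 1 *
        (ProjHM.gaussBinom (Nat.card F) (m - 1 + c) (m - 1) -
          ProjHM.gaussBinom (Nat.card F) (m - 2 + c) (m - 2)) +
        ProjHM.gaussBinom (Nat.card F) (m - 2 + c) (m - 2) := by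
    intro Γ hΓ hSeq
    rw [← ProjHM.ncard_core hV hm hΓ, hSeq]
    simp only [hspace, ProjHM.MeetAtLeast]
  have hspan' : ProjHM.IsSpanExample (t + m) t S →
      (S.ncard : ℚ) = ProjHM.gaussBinom (Nat.card F) (t + 1 + m + 1) 1 -
        ProjHM.gaussBinom (Nat.card F) (m + 1) 1 + (ProjHM.gaussBinom (Nat.card F) (m + c) m -
        (Nat.card F : ℚ) ^ ((m + 1) * m) * ProjHM.gaussBinom (Nat.card F) (c - 1) m) := by
    rintro ⟨δ, π, hδ, hπ, hπδ, hSeq⟩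
    exact hspanEq δ π hδ ((hspace π).1 hπ) hπδ hSeq
  have hcore' : ProjHM.IsCoreExample (t + m) t S →
      (S.ncard : ℚ) = ProjHM.gaussBinom (Nat.card F) (t + 1 + 2) 1 *
        (ProjHM.gaussBinom (Nat.card F) (m - 1 + c) (m - 1) -
          ProjHM.gaussBinom (Nat.card F) (m - 2 + c) (m - 2)) +
        ProjHM.gaussBinom (Nat.card F) (m - 2 + c) (m - 2) := by
    rintro ⟨Γ, hΓ, hSeq⟩
    refine hcoreEq Γ ?_ hSeq
    rw [ProjHM.IsSpace] at hΓ
    omega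
  set f₁ := ProjHM.gaussBinom (Nat.card F) (t + 1 + m + 1) 1 -
        ProjHM.gaussBinom (Nat.card F) (m + 1) 1 + (ProjHM.gaussBinom (Nat.card F) (m + c) m -
        (Nat.card F : ℚ) ^ ((m + 1) * m) * ProjHM.gaussBinom (Nat.card F) (c - 1) m) with hf₁
  set f₂ := ProjHM.gaussBinom (Nat.card F) (t + 1 + 2) 1 *
        (ProjHM.gaussBinom (Nat.card F) (m - 1 + c) (m - 1) -
          ProjHM.gaussBinom (Nat.card F) (m - 2 + c) (m - 2)) +
        ProjHM.gaussBinom (Nat.card F) (m - 2 + c) (m - 2) with hf₂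
  have hcases : ProjHM.IsCoreExample (t + m) t S ∨ ProjHM.IsSpanExample (t + m) t S ∨
      (S.ncard : ℚ) < f₁ := by
    rcases hM.eq_core_or_eq_span_or_ncard_lt hV (by omega) hm hqc hnt with
      ⟨Γ, hΓ, hSeq⟩ | ⟨δ, B, hδ, hB, hBδ, hSeq⟩ | hlt
    · refine Or.inl ⟨Γ, hΓ, ?_⟩
      simpa only [hspace, ProjHM.MeetAtLeast] using hSeq
    · refine Or.inr (Or.inl ⟨δ, B, hδ, (hspace B).2 hB, by omega, ?_⟩)
      simpa only [hspace, ProjHM.MeetAtLeast] using hSeq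
    · exact Or.inr (Or.inr (hlt.trans_le hlow))
  -- With k = t+m, the condition k > 2t+2 reads (t+1)+2 ≤ m, the threshold of `span_bounds` at
  -- linear dimension t+1. The two values are never equal, so only one example attains the maximum.
  rcases Nat.lt_or_ge (2 * t + 2) (t + m) with hkt | hkt
  · have hlt : f₂ < f₁ := hspan (by omega)
    rw [max_eq_left hlt.le]
    refine ⟨?_, ⟨fun heq => ?_, ?_⟩⟩
    · rcases hcases with h | h | h
      exacts [(hcore' h).trans_le hlt.le, (hspan' h).le, h.le]
    · rcases hcases with h | h | h
      · exact absurd ((hcore' h).symm.trans heq) hlt.ne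
      · exact Or.inl ⟨hkt, h⟩
      · exact absurd heq h.ne
    · rintro (⟨-, h⟩ | ⟨h, -⟩)
      · exact hspan' h
      · omega
  · have hlt : f₁ < f₂ := hcore (by omega)
    rw [max_eq_right hlt.le]
    refine ⟨?_, ⟨fun heq => ?_, ?_⟩⟩
    · rcases hcases with h | h | h
      exacts [(hcore' h).le, (hspan' h).trans_le hlt.le, (h.trans hlt).le]
    · rcases hcases with h | h | h
      · exact Or.inr ⟨hkt, h⟩
      · exact absurd ((hspan' h).symm.trans heq) hlt.ne
      · exact absurd heq (h.trans hlt).ne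
    · rintro (⟨h, -⟩ | ⟨-, h⟩)
      · omega
      · exact hcore' h
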